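/- Let $A,B,C$ be finite-dimensional quantum systems. For states $\rho,\sigma$ put $S(\rho)=-\mathrm{Tr}(\rho\log_2\rho)$ and $S(\rho\|\sigma)=-S(\rho)-\mathrm{Tr}(\rho\log_2\sigma)$ (equal to $+\infty$ unless $\ker\sigma\subseteq\ker\rho$). Let $\mathcal E_{X:Y}(\rho)=\min_\sigma S(\rho\|\sigma)$ over the separable states $\sigma=\sum_k p_k\,\rho_X^k\otimes\rho_Y^k$ (relative entropy of entanglement), and let $\mathcal D_{X|Y}(\rho)=\min_\chi S(\rho\|\chi)$ over the quantum-classical states $\chi=\sum_j p_j\,\chi_X^j\otimes|j\rangle\langle j|_Y$, with $\{|j\rangle\}$ any orthonormal basis of $Y$ (relative entropy of discord). For an orthonormal basis $\{|i\rangle\}$ of $C$ let $\Pi_C(\rho)=\sum_i(\mathbb 1\otimes|i\rangle\langle i|)\rho(\mathbb 1\otimes|i\rangle\langle i|)$ be the corresponding complete projective measurement on $C$; it is called optimal for $\mathcal D_{AB|C}(\rho)$ if it minimises $S(\Pi_C(\rho))-S(\rho)$ over all orthonormal bases of $C$. Let $\rho=\rho_{ABC}$ be any state. An optimal measurement exists.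 Let $\Pi_C^*$ be any optimal measurement, with outcome probabilities $p_i$ and conditional states $\rho^i_{AB}$, so that $\Pi^*_C(\rho)=\sum_i p_i\,\rho^i_{AB}\otimes|i\rangle\langle i|_C$. Then $$\mathcal E_{A:CB}(\rho)\le \mathcal D_{AB|C}(\rho)+\sum_i p_i\,\mathcal E_{A:B}(\rho^i_{AB}),$$ $$\sum_i p_i\,\mathcal E_{A:B}(\rho^i_{AB})=\mathcal E_{A:CB}(\Pi_C^*(\rho))=\mathcal E_{AC:B}(\Pi_C^*(\rho)).$$ This bound is in general strictly stronger than the bound $\mathcal E_{A:CB}(\rho)\le\mathcal D_{AB|C}(\rho)+\mathcal E_{AC:B}(\rho)$: one always has $$\mathcal D_{AB|C}(\rho)+\sum_i p_i\,\mathcal E_{A:B}(\rho^i_{AB})\le \mathcal D_{AB|C}(\rho)+\mathcal E_{AC:B}(\rho),$$ and for the three-qubit state $\rho=|\mathrm{GHZ}\rangle\langle\mathrm{GHZ}|$, $|\mathrm{GHZ}\rangle=(|000\rangle+|111\rangle)/\sqrt2$, there is an optimal measurement for which $$\mathcal E_{A:CB}(\rho)=\mathcal D_{AB|C}(\rho)+\sum_i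 p_i\,\mathcal E_{A:B}(\rho^i_{AB})<\mathcal D_{AB|C}(\rho)+\mathcal E_{AC:B}(\rho).$$ -/

import Mathlib

open scoped Kronecker ComplexOrder

namespace QCorr

noncomputable section

/-- Density matrices: positive semidefinite with unit trace. -/
def IsState {X : Type*} [Fintype X] (ρ : Matrix X X ℂ) : Prop :=
  ρ.PosSemidef ∧ ρ.trace = 1

/-- The rank-one operator `|v⟩⟨v|`. -/
def ketbra {X : Type*} (v : EuclideanSpace ℂ X) : Matrix X X ℂ :=
  Matrix.vecMulVec (fun x => v x) (fun x => star (v x))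

/-- Von Neumann entropy `S(ρ) = -Tr(ρ log₂ ρ)` in bits. The functional calculus uses
`Real.log 0 = 0`, which realises the convention `0 log 0 = 0`. -/
def entropy {X : Type*} [Fintype X] [DecidableEq X] (ρ : Matrix X X ℂ) : ℝ :=
  -((ρ * cfc Real.log ρ).trace.re / Real.log 2)

open Classical in
/-- Quantum relative entropy `S(ρ‖σ) = -S(ρ) - Tr(ρ log₂ σ)`, equal to `+∞` unless the
kernel of `σ` is contained in the kernel of `ρ`. -/
def relEntropy {X : Type*} [Fintype X] [DecidableEq X] (ρ σ : Matrix X X ℂ) : EReal :=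
  if ∀ v : X → ℂ, σ.mulVec v = 0 → ρ.mulVec v = 0 then
    ((-entropy ρ - (ρ * cfc Real.log σ).trace.re / Real.log 2 : ℝ) : EReal)
  else ⊤

/-- Separable states: `σ = ∑ k, p k • a k ⊗ b k` with `p` a probability vector. -/
def IsSeparable {X Y : Type*} [Fintype X] [Fintype Y]
    (σ : Matrix (X × Y) (X × Y) ℂ) : Prop :=
  ∃ (n : ℕ) (p : Fin n → ℝ) (a : Fin n → Matrix X X ℂ) (b : Fin n → Matrix Y Y ℂ),
    (∀ k, 0 ≤ p k) ∧ ∑ k, p k = 1 ∧ (∀ k, IsState (a k)) ∧ (∀ k, IsState (b k)) ∧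
      σ = ∑ k, (p k : ℂ) • (a k ⊗ₖ b k)

/-- Relative entropy of entanglement in the bipartition `X : Y`. -/
def ree {X Y : Type*} [Fintype X] [Fintype Y] [DecidableEq X] [DecidableEq Y]
    (ρ : Matrix (X × Y) (X × Y) ℂ) : EReal :=
  ⨅ (σ : Matrix (X × Y) (X × Y) ℂ) (_ : IsSeparable σ), relEntropy ρ σ

/-- Quantum-classical states: `χ = ∑ j, p j • τ j ⊗ |f j⟩⟨f j|` for an orthonormal basis `f`
of the second system. -/
def IsQuantumClassical {X Y : Type*} [Fintype X] [Fintype Y]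
    (χ : Matrix (X × Y) (X × Y) ℂ) : Prop :=
  ∃ (f : OrthonormalBasis Y ℂ (EuclideanSpace ℂ Y)) (p : Y → ℝ) (τ : Y → Matrix X X ℂ),
    (∀ j, 0 ≤ p j) ∧ ∑ j, p j = 1 ∧ (∀ j, IsState (τ j)) ∧
      χ = ∑ j, (p j : ℂ) • (τ j ⊗ₖ ketbra (f j))

/-- Relative entropy of discord `D_{X|Y}` (one-way quantum deficit). -/
def discord {X Y : Type*} [Fintype X] [Fintype Y] [DecidableEq X] [DecidableEq Y]
    (ρ : Matrix (X × Y) (X × Y) ℂ) : EReal :=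
  ⨅ (χ : Matrix (X × Y) (X × Y) ℂ) (_ : IsQuantumClassical χ), relEntropy ρ χ

/-- The unnormalised state `(1 ⊗ |e i⟩⟨e i|) ρ (1 ⊗ |e i⟩⟨e i|)` after outcome `i` of the
complete projective measurement of the second system in the orthonormal basis `e`. -/
def outcome {X Y : Type*} [Fintype X] [Fintype Y] [DecidableEq X]
    (e : OrthonormalBasis Y ℂ (EuclideanSpace ℂ Y)) (ρ : Matrix (X × Y) (X × Y) ℂ) (i : Y) :
    Matrix (X × Y) (X × Y) ℂ :=
  ((1 : Matrix X X ℂ) ⊗ₖ ketbra (e i)) * ρ * ((1 : Matrix X X ℂ) ⊗ₖ ketbra (e i))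

/-- The state `Π_Y(ρ)` after the (non-selective) measurement in the basis `e`. -/
def measured {X Y : Type*} [Fintype X] [Fintype Y] [DecidableEq X]
    (e : OrthonormalBasis Y ℂ (EuclideanSpace ℂ Y)) (ρ : Matrix (X × Y) (X × Y) ℂ) :
    Matrix (X × Y) (X × Y) ℂ :=
  ∑ i, outcome e ρ i

/-- The probability of outcome `i`. -/
def prob {X Y : Type*} [Fintype X] [Fintype Y] [DecidableEq X]
    (e : OrthonormalBasis Y ℂ (EuclideanSpace ℂ Y)) (ρ : Matrix (X × Y) (X × Y) ℂ) (i : Y) : ℝ :=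
  (outcome e ρ i).trace.re

/-- Partial trace over the second system. -/
def partialTrace {X Y : Type*} [Fintype Y] (ρ : Matrix (X × Y) (X × Y) ℂ) : Matrix X X ℂ :=
  Matrix.of fun x x' => ∑ y, ρ (x, y) (x', y)

/-- The conditional state of the first system given outcome `i` (the zero matrix if that
outcome has probability zero, where it is always weighted by zero). -/
def condState {X Y : Type*} [Fintype X] [Fintype Y] [DecidableEq X]
    (e : OrthonormalBasis Y ℂ (EuclideanSpace ℂ Y)) (ρ : Matrix (X × Y) (X × Y) ℂ) (i : Y) :
    Matrix X X ℂ :=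
  ((prob e ρ i : ℂ))⁻¹ • partialTrace (outcome e ρ i)

/-- The complete projective measurement in the basis `e` is optimal for `D_{X|Y}(ρ)`:
it minimises the entropy increase `S(Π_Y(ρ)) - S(ρ)`. -/
def IsOptimal {X Y : Type*} [Fintype X] [Fintype Y] [DecidableEq X] [DecidableEq Y]
    (e : OrthonormalBasis Y ℂ (EuclideanSpace ℂ Y)) (ρ : Matrix (X × Y) (X × Y) ℂ) : Prop :=
  ∀ f : OrthonormalBasis Y ℂ (EuclideanSpace ℂ Y),
    entropy (measured e ρ) - entropy ρ ≤ entropy (measured f ρ) - entropy ρ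

/-- A tripartite operator on `ABC`, read as a bipartite one in the cut `A : CB`. -/
def cutA {A B C : Type*} (ρ : Matrix ((A × B) × C) ((A × B) × C) ℂ) :
    Matrix (A × (C × B)) (A × (C × B)) ℂ :=
  ρ.submatrix (fun x => ((x.1, x.2.2), x.2.1)) (fun x => ((x.1, x.2.2), x.2.1))

/-- A tripartite operator on `ABC`, read as a bipartite one in the cut `AC : B`. -/
def cutB {A B C : Type*} (ρ : Matrix ((A × B) × C) ((A × B) × C) ℂ) :
    Matrix ((A × C) × B) ((A × C) × B) ℂ :=
  ρ.submatrix (fun x => ((x.1.1, x.2), x.1.2)) (fun x => ((x.1.1, x.2), x.1.2))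

/-- `E_{A:CB}(ρ)`. -/
def reeA {A B C : Type*} [Fintype A] [Fintype B] [Fintype C]
    [DecidableEq A] [DecidableEq B] [DecidableEq C]
    (ρ : Matrix ((A × B) × C) ((A × B) × C) ℂ) : EReal :=
  ree (cutA ρ)

/-- `E_{AC:B}(ρ)`. -/
def reeB {A B C : Type*} [Fintype A] [Fintype B] [Fintype C]
    [DecidableEq A] [DecidableEq B] [DecidableEq C]
    (ρ : Matrix ((A × B) × C) ((A × B) × C) ℂ) : EReal :=
  ree (cutB ρ)

/-- `∑ i, p i * E_{A:B}(ρ^i_{AB})` for the measurement of `C` in the basis `e`. -/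
def avgRee {A B C : Type*} [Fintype A] [Fintype B] [Fintype C]
    [DecidableEq A] [DecidableEq B]
    (e : OrthonormalBasis C ℂ (EuclideanSpace ℂ C))
    (ρ : Matrix ((A × B) × C) ((A × B) × C) ℂ) : EReal :=
  ∑ i, (prob e ρ i : EReal) * ree (condState e ρ i)

/-- The vector `(|000⟩ + |111⟩)/√2`. -/
def ghzVec : EuclideanSpace ℂ ((Fin 2 × Fin 2) × Fin 2) :=
  WithLp.toLp 2 fun x => if x.1.1 = x.1.2 ∧ x.1.2 = x.2 then ((Real.sqrt 2 : ℝ) : ℂ)⁻¹ else 0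

/-- The Greenberger–Horne–Zeilinger state. -/
def ghz : Matrix ((Fin 2 × Fin 2) × Fin 2) ((Fin 2 × Fin 2) × Fin 2) ℂ :=
  ketbra ghzVec

end

end QCorr

open QCorr

/-! Measuring `C` in a basis `e` cuts `ABC` into orthogonal blocks, the ranges of the isometries `x
↦ x ⊗ e i` (`isoCol`), and `Π_C` keeps the diagonal blocks. The logarithm of a block-diagonal
operator is block-diagonal, so for `σ` with blocks `τ i` S(ρ‖σ) = S(ρ‖Π(ρ)) + ∑ i, S(block i of ρ ‖
τ i) (`IsBlockFamily.qd_blockSum_right`), and S(ρ‖Π(ρ)) = S(Π(ρ)) - S(ρ). With Klein's inequality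
for the last sum, this identifies the discord with the smallest entropy increase.

Upper bound: take `τ i = p i • τ' i` with `τ' i` a nearly closest separable state to the conditional
state. The resulting `σ` is separable in the cut under study, and the first term is the discord when
`e` is optimal (`IsBlockCone.exists_qd_le`).

Lower bound: `∑ p i E(ρ i) ≤ E(ρ)` in either cut, because pinching does not increase relative
entropy and separability passes to blocks (`IsBlockCone.sum_le_qd`). For `ρ` itself in the cut `AC :
B` this compares the two bounds; for `Π(ρ)`, together with the upper bound, it gives both
equalities. The cuts are treated together through cones compatible with the blocks (`IsBlockCone`).

Pinching monotonicity (`IsBlockFamily.sum_qd_block_le`) is reduced to quadratic functionals: for `t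
> 0` the sum `∑ |⟨b|a⟩|² r_a² / (s_b + t r_a)` is a maximum over operators `Y`, and block-diagonal
`Y` see only the blocks. Integrating over `t` recovers the logarithms.

An optimal basis exists because the entropy is continuous and orthonormal frames form a compact set.
A separable state overlaps GHZ by at most `1/2`, so GHZ is at least one bit away in every cut; the
computational basis gives discord one and product conditional states. -/

namespace QCorr

open Matrix Polynomial

set_option linter.unusedSectionVars false

noncomputable section

/-! ### Functional calculus of matrices and block decompositions -/

section FunctionalCalculus

variable {n m ι : Type*} [Fintype n] [DecidableEq n] [Fintype m] [DecidableEq m]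
  [Fintype ι] [DecidableEq ι]

/-- Spectra of matrices are finite, so interpolation turns every `cfc` into a polynomial, which
commutes with any algebra homomorphism. -/
theorem exists_polynomial_eval_eq (S : Finset ℝ) (f : ℝ → ℝ) :
    ∃ p : ℝ[X], ∀ s ∈ S, p.eval s = f s :=
  ⟨Lagrange.interpolate S id f, fun _ hs =>
    Lagrange.eval_interpolate_at_node f (Set.injOn_id _) hs⟩

theorem cfc_eq_aeval {A : Matrix n n ℂ} (hA : A.IsHermitian) {f : ℝ → ℝ} {p : ℝ[X]}
    (hp : ∀ s ∈ spectrum ℝ A, p.eval s = f s) : cfc f A = aeval A p := by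
  rw [← cfc_polynomial p A hA]
  exact cfc_congr fun s hs => (hp s hs).symm

/-- `A` is diagonalised by the unitary `U` with real diagonal entries `d`. -/
structure HasDiag (A U : Matrix n n ℂ) (d : n → ℝ) : Prop where
  left : Uᴴ * U = 1
  right : U * Uᴴ = 1
  eq : A = U * diagonal (fun i => (d i : ℂ)) * Uᴴ

theorem exists_hasDiag {A : Matrix n n ℂ} (hA : A.IsHermitian) :
    ∃ U, HasDiag A U hA.eigenvalues := by
  refine ⟨hA.eigenvectorUnitary, ?_, ?_, ?_⟩
  · exact Unitary.coe_star_mul_self hA.eigenvectorUnitary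
  · exact Unitary.coe_mul_star_self hA.eigenvectorUnitary
  · conv_lhs => rw [hA.spectral_theorem]
    rfl

/-- Conjugation of real diagonal matrices by a unitary, as an algebra homomorphism. -/
def diagHom (U : Matrix n n ℂ) (h₁ : Uᴴ * U = 1) (h₂ : U * Uᴴ = 1) :
    (n → ℝ) →ₐ[ℝ] Matrix n n ℂ :=
  AlgHom.ofLinearMap
    { toFun := fun d => U * diagonal (fun i => (d i : ℂ)) * Uᴴ
      map_add' := fun d d' => by
        rw [← add_mul, ← mul_add, diagonal_add]; simp
      map_smul' := fun c d => by
        rw [RingHom.id_apply, ← smul_mul_assoc, ← mul_smul_comm, ← diagonal_smul]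
        congr 3; ext i; simp }
    (by simp [h₂])
    (fun d d' => by
      change U * diagonal (fun i => ((d i * d' i : ℝ) : ℂ)) * Uᴴ =
        U * diagonal (fun i => (d i : ℂ)) * Uᴴ * (U * diagonal (fun i => (d' i : ℂ)) * Uᴴ)
      simp only [Matrix.mul_assoc]
      rw [← Matrix.mul_assoc Uᴴ U, h₁, Matrix.one_mul, ← Matrix.mul_assoc (diagonal _) (diagonal _),
        diagonal_mul_diagonal]
      simp)

theorem aeval_pi_apply {κ R : Type*} [Ring R] [Algebra ℝ R] (x : κ → R) (p : ℝ[X]) (i : κ) :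
    aeval x p i = aeval (x i) p :=
  (aeval_algHom_apply (Pi.evalAlgHom ℝ (fun _ : κ => R) i) x p).symm

theorem HasDiag.isHermitian {A U : Matrix n n ℂ} {d : n → ℝ} (h : HasDiag A U d) :
    A.IsHermitian := by
  rw [h.eq, IsHermitian, conjTranspose_mul, conjTranspose_mul, conjTranspose_conjTranspose,
    diagonal_conjTranspose, Matrix.mul_assoc]
  congr 3; ext i; simp

theorem HasDiag.cfc {A U : Matrix n n ℂ} {d : n → ℝ} (h : HasDiag A U d) (f : ℝ → ℝ) :
    HasDiag (cfc f A) U (fun i => f (d i)) := by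
  refine ⟨h.left, h.right, ?_⟩
  have hA := h.isHermitian
  -- Interpolating at the entries of `d` as well avoids having to show that they lie in the
  -- spectrum.
  obtain ⟨p, hp⟩ := exists_polynomial_eval_eq
    ((finite_real_spectrum (A := A)).toFinset ∪ Finset.univ.image d) f
  rw [cfc_eq_aeval hA (p := p) fun s hs => hp s (by simp [hs])]
  have e : A = diagHom U h.left h.right d := h.eq
  rw [e, aeval_algHom_apply]
  change U * diagonal (fun i => ((aeval d p i : ℝ) : ℂ)) * Uᴴ = _
  congr 3; ext i
  rw [aeval_pi_apply, ← hp (d i) (by simp)]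
  simp

theorem HasDiag.smul {A U : Matrix n n ℂ} {d : n → ℝ} (h : HasDiag A U d) (c : ℝ) :
    HasDiag ((c : ℂ) • A) U (fun i => c * d i) := by
  refine ⟨h.left, h.right, ?_⟩
  rw [h.eq, ← smul_mul_assoc, ← mul_smul_comm, ← diagonal_smul]
  congr 3; ext i; simp

theorem cfc_submatrix {l : Type*} [Fintype l] [DecidableEq l] (e : l ≃ n) {A : Matrix n n ℂ}
    (hA : A.IsHermitian) (f : ℝ → ℝ) : cfc f (A.submatrix e e) = (cfc f A).submatrix e e := by
  obtain ⟨p, hp⟩ := exists_polynomial_eval_eq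
    ((finite_real_spectrum (A := A)).toFinset ∪
      (finite_real_spectrum (A := A.submatrix e e)).toFinset) f
  rw [cfc_eq_aeval hA (p := p) fun s hs => hp s (by simp [hs]),
    cfc_eq_aeval (hA.submatrix e) (p := p) fun s hs => hp s (by simp [hs])]
  exact aeval_algHom_apply (reindexAlgEquiv ℝ ℂ e.symm).toAlgHom A p

/-- A family of isometries whose ranges decompose the space orthogonally. -/
structure IsBlockFamily (V : ι → Matrix n m ℂ) : Prop where
  orth : ∀ i j, (V i)ᴴ * V j = if i = j then 1 else 0
  complete : ∑ i, V i * (V i)ᴴ = 1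

/-- The block-diagonal operator with blocks `τ i`. -/
def blockSum (V : ι → Matrix n m ℂ) (τ : ι → Matrix m m ℂ) : Matrix n n ℂ :=
  ∑ i, V i * τ i * (V i)ᴴ

/-- The diagonal block `i` of `ρ`. -/
def block (V : ι → Matrix n m ℂ) (ρ : Matrix n n ℂ) (i : ι) : Matrix m m ℂ :=
  (V i)ᴴ * ρ * V i

namespace IsBlockFamily

variable {V : ι → Matrix n m ℂ} (hV : IsBlockFamily V)
include hV

theorem blockSum_mul (τ τ' : ι → Matrix m m ℂ) :
    blockSum V τ * blockSum V τ' = blockSum V (fun i => τ i * τ' i) := by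
  simp only [blockSum, Finset.sum_mul_sum]
  refine Finset.sum_congr rfl fun i _ => ?_
  rw [Finset.sum_eq_single i]
  · have := hV.orth i i
    simp only [if_true] at this
    calc _ = V i * τ i * ((V i)ᴴ * V i) * τ' i * (V i)ᴴ := by simp only [Matrix.mul_assoc]
      _ = _ := by rw [this]; simp only [Matrix.mul_assoc, Matrix.one_mul]
  · intro j _ hj
    calc _ = V i * τ i * ((V i)ᴴ * V j) * τ' j * (V j)ᴴ := by simp only [Matrix.mul_assoc]
      _ = _ := by rw [hV.orth i j, if_neg hj.symm]; simp
  · simp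

theorem block_blockSum (τ : ι → Matrix m m ℂ) (i : ι) : block V (blockSum V τ) i = τ i := by
  simp only [block, blockSum, Matrix.mul_sum, Matrix.sum_mul]
  have h (j : ι) : (V i)ᴴ * (V j * τ j * (V j)ᴴ) * V i = if j = i then τ j else 0 := by
    calc _ = ((V i)ᴴ * V j) * τ j * ((V j)ᴴ * V i) := by simp only [Matrix.mul_assoc]
      _ = _ := by
        rw [hV.orth i j, hV.orth j i]
        by_cases h : j = i
        · subst h; simp
        · simp [h, Ne.symm h]
  simp [h]

/-- The passage to block-diagonal operators as an algebra homomorphism. -/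
def hom : (ι → Matrix m m ℂ) →ₐ[ℝ] Matrix n n ℂ :=
  AlgHom.ofLinearMap
    { toFun := blockSum V
      map_add' := fun τ τ' => by
        simp [blockSum, Matrix.mul_add, Matrix.add_mul, Finset.sum_add_distrib]
      map_smul' := fun c τ => by
        simp [blockSum, Finset.smul_sum] }
    (by
      change ∑ i, V i * (1 : Matrix m m ℂ) * (V i)ᴴ = 1
      simpa using hV.complete)
    (fun τ τ' => (hV.blockSum_mul τ τ').symm)

omit hV in
theorem _root_.QCorr.isHermitian_blockSum {τ : ι → Matrix m m ℂ} (hτ : ∀ i, (τ i).IsHermitian) :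
    (blockSum V τ).IsHermitian := by
  simp only [blockSum, IsHermitian, conjTranspose_sum, conjTranspose_mul,
    conjTranspose_conjTranspose, (hτ _).eq, Matrix.mul_assoc]

/-- A single polynomial interpolates `f` on the spectra of the whole operator and of all blocks;
`hom` commutes with it. -/
theorem cfc_blockSum {τ : ι → Matrix m m ℂ} (hτ : ∀ i, (τ i).IsHermitian) (f : ℝ → ℝ) :
    cfc f (blockSum V τ) = blockSum V (fun i => cfc f (τ i)) := by
  obtain ⟨p, hp⟩ := exists_polynomial_eval_eq
    ((finite_real_spectrum (A := blockSum V τ)).toFinset ∪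
      Finset.univ.biUnion fun i => (finite_real_spectrum (A := τ i)).toFinset) f
  rw [cfc_eq_aeval (isHermitian_blockSum hτ) (p := p) fun s hs => hp s (by simp [hs])]
  have : (fun i => cfc f (τ i)) = aeval τ p := by
    ext1 i
    rw [aeval_pi_apply]
    refine cfc_eq_aeval (hτ i) fun s hs => hp s ?_
    simp only [Finset.mem_union, Finset.mem_biUnion, Finset.mem_univ, true_and,
      Set.Finite.mem_toFinset]
    exact Or.inr ⟨i, hs⟩
  rw [this]
  exact aeval_algHom_apply hV.hom τ p

omit hV in
theorem _root_.QCorr.trace_mul_blockSum (ρ : Matrix n n ℂ) (τ : ι → Matrix m m ℂ) :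
    (ρ * blockSum V τ).trace = ∑ i, (block V ρ i * τ i).trace := by
  simp only [blockSum, block, Matrix.mul_sum, trace_sum]
  refine Finset.sum_congr rfl fun i _ => ?_
  rw [← Matrix.mul_assoc, trace_mul_comm]
  simp only [Matrix.mul_assoc]

theorem trace_blockSum (τ : ι → Matrix m m ℂ) :
    (blockSum V τ).trace = ∑ i, (τ i).trace := by
  have := trace_mul_blockSum (V := V) 1 τ
  rw [Matrix.one_mul] at this
  rw [this]
  refine Finset.sum_congr rfl fun i _ => ?_
  simp [block, hV.orth]

theorem sum_trace_block (ρ : Matrix n n ℂ) : ∑ i, (block V ρ i).trace = ρ.trace := by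
  have := trace_mul_blockSum (V := V) ρ (fun _ => 1)
  simp only [Matrix.mul_one] at this
  rw [← this]
  simp [blockSum, hV.complete]

end IsBlockFamily

theorem posSemidef_block {V : ι → Matrix n m ℂ} {ρ : Matrix n n ℂ} (hρ : ρ.PosSemidef) (i : ι) :
    (block V ρ i).PosSemidef :=
  hρ.conjTranspose_mul_mul_same (V i)

theorem posSemidef_blockSum {V : ι → Matrix n m ℂ} {τ : ι → Matrix m m ℂ}
    (hτ : ∀ i, (τ i).PosSemidef) : (blockSum V τ).PosSemidef :=
  posSemidef_sum _ fun i _ => (hτ i).mul_mul_conjTranspose_same (V i)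

end FunctionalCalculus

/-! ### From quadratic quantities to logarithms -/

section ScalarInequality

open Filter Topology

/-- This makes the quadratic quantity at `T` the derivative of a logarithmic one. When `s = 0` the
function is constant, since then `w * r = 0`. -/
theorem hasDerivAt_mul_log_add {w r s T : ℝ} (hr : 0 ≤ r) (hs : 0 ≤ s)
    (hz : s = 0 → w * r = 0) (hT : 0 ≤ T) :
    HasDerivAt (fun T => w * (r * Real.log (s + T * r) - r * Real.log s))
      (w * (r ^ 2 / (s + T * r))) T := by
  rcases eq_or_ne (w * r) 0 with h | h
  · have e₁ : (fun T => w * (r * Real.log (s + T * r) - r * Real.log s)) = fun _ => 0 := by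
      funext T
      linear_combination (Real.log (s + T * r) - Real.log s) * h
    have e₂ : w * (r ^ 2 / (s + T * r)) = 0 := by
      linear_combination (r / (s + T * r)) * h
    rw [e₁, e₂]
    exact hasDerivAt_const T 0
  · have hs' : 0 < s := lt_of_le_of_ne hs fun h' => h (hz h'.symm)
    have hpos : s + T * r ≠ 0 := by positivity
    have h₁ : HasDerivAt (fun T => s + T * r) r T := by
      simpa using ((hasDerivAt_id T).mul_const r).const_add s
    refine ((((h₁.log hpos).const_mul r).sub_const (r * Real.log s)).const_mul w).congr_deriv ?_
    ring

/-- Since `log (s + T r) = log T + log (s / T + r)`, the divergence involves only `w * r`, and it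
cancels between two families with equal `∑ w r`. -/
theorem tendsto_mul_log_add {w r s : ℝ} (hr : 0 ≤ r) (hs : 0 ≤ s) :
    Tendsto (fun T => w * (r * Real.log (s + T * r) - r * Real.log s) - Real.log T * (w * r))
      atTop (𝓝 (w * (r * Real.log r - r * Real.log s))) := by
  rcases eq_or_lt_of_le hr with h | h
  · subst h; simp
  have h₁ : Tendsto (fun T : ℝ => s / T + r) atTop (𝓝 r) := by
    simpa using (tendsto_const_nhds.div_atTop tendsto_id : Tendsto (fun T : ℝ => s / T) atTop _).add_const r
  have h₂ := (((h₁.log h.ne').const_mul r).sub_const (r * Real.log s)).const_mul w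
  refine h₂.congr' ?_
  filter_upwards [eventually_gt_atTop 0] with T hT
  have : s / T + r = (s + T * r) / T := by field_simp
  rw [this, Real.log_div (by positivity) hT.ne']
  ring

/-- Comparing the quadratic quantities `r² / (s + t r)` for all `t > 0` compares the relative
entropies `r log r - r log s`. -/
theorem sum_mul_log_le_of_sum_sq_div_le {κ κ' : Type*} [Fintype κ] [Fintype κ']
    {w r s : κ → ℝ} {w' r' s' : κ' → ℝ}
    (hr : ∀ k, 0 ≤ r k) (hs : ∀ k, 0 ≤ s k) (hz : ∀ k, s k = 0 → w k * r k = 0)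
    (hr' : ∀ k, 0 ≤ r' k) (hs' : ∀ k, 0 ≤ s' k) (hz' : ∀ k, s' k = 0 → w' k * r' k = 0)
    (hQ : ∀ t, 0 < t → ∑ k, w k * (r k ^ 2 / (s k + t * r k)) ≤
      ∑ k, w' k * (r' k ^ 2 / (s' k + t * r' k)))
    (hsum : ∑ k, w k * r k = ∑ k, w' k * r' k) :
    ∑ k, w k * (r k * Real.log (r k) - r k * Real.log (s k)) ≤
      ∑ k, w' k * (r' k * Real.log (r' k) - r' k * Real.log (s' k)) := by
  set F : ℝ → ℝ := fun T =>
    ∑ k, w k * (r k * Real.log (s k + T * r k) - r k * Real.log (s k))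
  set F' : ℝ → ℝ := fun T =>
    ∑ k, w' k * (r' k * Real.log (s' k + T * r' k) - r' k * Real.log (s' k))
  -- `F' - F` vanishes at `0`, is nondecreasing by `hQ`, and tends at infinity to the difference of
  -- the two sides of the claim.
  have hF (T : ℝ) (hT : 0 ≤ T) : HasDerivAt (fun T => F' T - F T)
      (∑ k, w' k * (r' k ^ 2 / (s' k + T * r' k)) - ∑ k, w k * (r k ^ 2 / (s k + T * r k))) T :=
    (HasDerivAt.fun_sum fun k _ => hasDerivAt_mul_log_add (hr' k) (hs' k) (hz' k) hT).sub
      (HasDerivAt.fun_sum fun k _ => hasDerivAt_mul_log_add (hr k) (hs k) (hz k) hT)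
  have hmono : MonotoneOn (fun T => F' T - F T) (Set.Ici 0) := by
    refine monotoneOn_of_deriv_nonneg (convex_Ici 0)
      (fun T hT => (hF T hT).continuousAt.continuousWithinAt)
      (fun T hT => ?_) (fun T hT => ?_) <;> rw [interior_Ici, Set.mem_Ioi] at hT
    · exact (hF T hT.le).differentiableAt.differentiableWithinAt
    · rw [(hF T hT.le).deriv]
      exact sub_nonneg.2 (hQ T hT)
  have hlim : Tendsto (fun T => F' T - F T) atTop
      (𝓝 (∑ k, w' k * (r' k * Real.log (r' k) - r' k * Real.log (s' k)) -
        ∑ k, w k * (r k * Real.log (r k) - r k * Real.log (s k)))) := by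
    have h₁ := (tendsto_finsetSum Finset.univ fun k _ =>
      tendsto_mul_log_add (w := w' k) (hr' k) (hs' k)).sub
      (tendsto_finsetSum Finset.univ fun k _ =>
      tendsto_mul_log_add (w := w k) (hr k) (hs k))
    refine h₁.congr fun T => ?_
    simp only [Finset.sum_sub_distrib, ← Finset.mul_sum, hsum, F, F']
    ring
  refine sub_nonneg.1 (ge_of_tendsto hlim ?_)
  filter_upwards [eventually_ge_atTop 0] with T hT
  have h0 := hmono (Set.self_mem_Ici) hT hT
  simpa [F, F'] using h0

end ScalarInequality

/-! ### Relative entropy: Klein's inequality, pinching, block identity -/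

section RelativeEntropy

variable {n m ι : Type*} [Fintype n] [DecidableEq n] [Fintype m] [DecidableEq m]
  [Fintype ι] [DecidableEq ι]

/-- The finite value `Tr ρ log ρ - Tr ρ log σ` of the relative entropy, in nats. -/
def qd (ρ σ : Matrix n n ℂ) : ℝ :=
  (ρ * cfc Real.log ρ).trace.re - (ρ * cfc Real.log σ).trace.re

/-- The kernel of `σ` is contained in that of `ρ`. -/
def KerLE (σ ρ : Matrix n n ℂ) : Prop := ∀ v : n → ℂ, σ.mulVec v = 0 → ρ.mulVec v = 0

theorem relEntropy_of_kerLE {ρ σ : Matrix n n ℂ} (h : KerLE σ ρ) :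
    relEntropy ρ σ = ((qd ρ σ / Real.log 2 : ℝ) : EReal) := by
  refine (if_pos h).trans ?_
  rw [entropy, qd]
  congr 1; ring

theorem relEntropy_of_not_kerLE {ρ σ : Matrix n n ℂ} (h : ¬ KerLE σ ρ) :
    relEntropy ρ σ = ⊤ := if_neg h

theorem exists_hasDiag_of_posSemidef {A : Matrix n n ℂ} (hA : A.PosSemidef) :
    ∃ U d, HasDiag A U d ∧ ∀ i, 0 ≤ d i := by
  obtain ⟨U, hU⟩ := exists_hasDiag hA.isHermitian
  exact ⟨U, _, hU, hA.eigenvalues_nonneg⟩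

theorem HasDiag.mul {A B U : Matrix n n ℂ} {d d' : n → ℝ} (h : HasDiag A U d)
    (h' : HasDiag B U d') : HasDiag (A * B) U (fun i => d i * d' i) := by
  refine ⟨h.left, h.right, ?_⟩
  have := map_mul (diagHom U h.left h.right) d d'
  rw [h.eq, h'.eq]
  exact this.symm

theorem hasDiag_one {U : Matrix n n ℂ} (h₁ : Uᴴ * U = 1) (h₂ : U * Uᴴ = 1) :
    HasDiag 1 U (fun _ => 1) := ⟨h₁, h₂, by simp [h₂]⟩

/-- Squared overlaps of the columns of two matrices. -/
def overlap (W U : Matrix n n ℂ) (b a : n) : ℝ := Complex.normSq ((Wᴴ * U) b a)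

theorem overlap_nonneg (W U : Matrix n n ℂ) (b a : n) : 0 ≤ overlap W U b a :=
  Complex.normSq_nonneg _

theorem HasDiag.trace_mul {ρ σ U W : Matrix n n ℂ} {r s : n → ℝ} (hρ : HasDiag ρ U r)
    (hσ : HasDiag σ W s) :
    (ρ * σ).trace.re = ∑ a, ∑ b, overlap W U b a * (r a * s b) := by
  have h₁ : (ρ * σ).trace = (diagonal (fun i => (r i : ℂ)) * ((Wᴴ * U)ᴴ *
      (diagonal (fun i => (s i : ℂ)) * (Wᴴ * U)))).trace := by
    rw [hρ.eq, hσ.eq, conjTranspose_mul, conjTranspose_conjTranspose]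
    simp only [Matrix.mul_assoc]
    rw [trace_mul_comm U]
    simp only [Matrix.mul_assoc]
  rw [h₁, trace, Complex.re_sum]
  refine Finset.sum_congr rfl fun a _ => ?_
  rw [diag_apply, diagonal_mul, Matrix.mul_apply, Finset.mul_sum, Complex.re_sum]
  refine Finset.sum_congr rfl fun b _ => ?_
  rw [diagonal_mul, conjTranspose_apply, overlap, Complex.normSq_apply]
  generalize (Wᴴ * U) b a = z
  simp
  ring

theorem HasDiag.trace_left {ρ σ U W : Matrix n n ℂ} {r s : n → ℝ} (hρ : HasDiag ρ U r)
    (hσ : HasDiag σ W s) : ρ.trace.re = ∑ a, ∑ b, overlap W U b a * r a := by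
  have := hρ.trace_mul (hasDiag_one hσ.left hσ.right)
  simpa using this

theorem HasDiag.trace_right {ρ σ U W : Matrix n n ℂ} {r s : n → ℝ} (hρ : HasDiag ρ U r)
    (hσ : HasDiag σ W s) : σ.trace.re = ∑ a, ∑ b, overlap W U b a * s b := by
  have := (hasDiag_one hρ.left hρ.right).trace_mul hσ
  simpa using this

/-- In the two eigenbases the relative entropy becomes a classical sum over pairs of eigenvalues,
weighted by squared overlaps. -/
theorem HasDiag.qd_eq {ρ σ U W : Matrix n n ℂ} {r s : n → ℝ} (hρ : HasDiag ρ U r)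
    (hσ : HasDiag σ W s) : qd ρ σ = ∑ a, ∑ b,
      overlap W U b a * (r a * Real.log (r a) - r a * Real.log (s b)) := by
  rw [qd, (hρ.mul (hρ.cfc Real.log)).trace_left hσ, hρ.trace_mul (hσ.cfc Real.log)]
  simp only [mul_sub, Finset.sum_sub_distrib]

/-- The column `b` of `W` lies in the kernel of `σ`, hence in that of `ρ`, and its coordinate on the
column `a` of `U` gives the claim. The terms affected by `Real.log 0 = 0` therefore carry no weight.
-/
theorem HasDiag.mul_eq_zero_of_kerLE {ρ σ U W : Matrix n n ℂ} {r s : n → ℝ}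
    (hρ : HasDiag ρ U r) (hσ : HasDiag σ W s) (h : KerLE σ ρ) (a b : n) (hb : s b = 0) :
    overlap W U b a * r a = 0 := by
  have h₁ : σ *ᵥ (W *ᵥ Pi.single b 1) = 0 := by
    rw [mulVec_mulVec, hσ.eq, Matrix.mul_assoc, hσ.left, Matrix.mul_one, ← mulVec_mulVec]
    have : diagonal (fun i => (s i : ℂ)) *ᵥ Pi.single b 1 = 0 := by
      ext i
      rw [mulVec_diagonal]
      rcases eq_or_ne i b with rfl | h
      · simp [hb]
      · simp [h]
    rw [this, mulVec_zero]
  have h₂ := congrArg (fun v => (Uᴴ *ᵥ v) a) (h _ h₁)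
  simp only [mulVec_mulVec, mulVec_zero, Pi.zero_apply] at h₂
  have h₃ : Uᴴ * (ρ * W) = diagonal (fun i => (r i : ℂ)) * (Wᴴ * U)ᴴ := by
    rw [hρ.eq, conjTranspose_mul, conjTranspose_conjTranspose]
    simp only [← Matrix.mul_assoc]
    rw [hρ.left, Matrix.one_mul]
  rw [h₃, mulVec_single_one, col_apply, diagonal_mul, conjTranspose_apply] at h₂
  rcases mul_eq_zero.1 h₂ with h₄ | h₄
  · simp [Complex.ofReal_eq_zero.1 h₄]
  · simp [overlap, star_eq_zero.1 h₄]

/-- Klein's inequality. -/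
theorem trace_sub_trace_le_qd {ρ σ : Matrix n n ℂ} (hρ : ρ.PosSemidef) (hσ : σ.PosSemidef)
    (h : KerLE σ ρ) : ρ.trace.re - σ.trace.re ≤ qd ρ σ := by
  obtain ⟨U, r, hU, hr⟩ := exists_hasDiag_of_posSemidef hρ
  obtain ⟨W, s, hW, hs⟩ := exists_hasDiag_of_posSemidef hσ
  rw [hU.qd_eq hW, hU.trace_left hW, hU.trace_right hW]
  simp only [← Finset.sum_sub_distrib]
  refine Finset.sum_le_sum fun a _ => Finset.sum_le_sum fun b _ => ?_
  have hw := overlap_nonneg W U b a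
  have h0 := hU.mul_eq_zero_of_kerLE hW h a b
  rcases eq_or_lt_of_le (hs b) with hb | hb
  · have := h0 hb.symm
    have e : overlap W U b a * (r a * Real.log (r a) - r a * Real.log (s b)) = 0 := by
      linear_combination (Real.log (r a) - Real.log (s b)) * this
    rw [e, this, ← hb, mul_zero, sub_zero]
  rcases eq_or_lt_of_le (hr a) with ha | ha
  · rw [← ha]
    simp only [mul_zero, zero_mul, sub_zero]
    nlinarith
  rw [← mul_sub]
  refine mul_le_mul_of_nonneg_left ?_ hw
  have h₁ := Real.log_le_sub_one_of_pos (div_pos hb ha)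
  rw [Real.log_div hb.ne' ha.ne'] at h₁
  have h₂ : s b / r a * r a = s b := by field_simp
  nlinarith

theorem qd_self (ρ : Matrix n n ℂ) : qd ρ ρ = 0 := sub_self _

theorem qd_zero_left (σ : Matrix n n ℂ) : qd 0 σ = 0 := by simp [qd]

theorem qd_smul_smul {ρ σ : Matrix n n ℂ} (hρ : ρ.PosSemidef) (hσ : σ.PosSemidef)
    (h : KerLE σ ρ) {p q : ℝ} (hq : 0 < q) :
    qd ((p : ℂ) • ρ) ((q : ℂ) • σ) =
      p * qd ρ σ + (p * Real.log p - p * Real.log q) * ρ.trace.re := by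
  obtain ⟨U, r, hU, hr⟩ := exists_hasDiag_of_posSemidef hρ
  obtain ⟨W, s, hW, hs⟩ := exists_hasDiag_of_posSemidef hσ
  rw [(hU.smul p).qd_eq (hW.smul q), hU.qd_eq hW, hU.trace_left hW]
  simp only [Finset.mul_sum, ← Finset.sum_add_distrib]
  refine Finset.sum_congr rfl fun a _ => Finset.sum_congr rfl fun b _ => ?_
  have h0 := hU.mul_eq_zero_of_kerLE hW h a b
  rcases eq_or_ne (overlap W U b a * r a) 0 with h₁ | h₁
  · linear_combination (p * Real.log (p * r a) - p * Real.log (q * s b) -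
      p * Real.log (r a) + p * Real.log (s b) - p * Real.log p + p * Real.log q) * h₁
  have hsb : s b ≠ 0 := fun h' => h₁ (h0 h')
  have hra : r a ≠ 0 := right_ne_zero_of_mul h₁
  rcases eq_or_ne p 0 with rfl | hp
  · simp
  rw [Real.log_mul hp hra, Real.log_mul hq.ne' hsb]
  ring

/-- The quadratic functional whose supremum over `Y` is
`∑ |⟨a|b⟩|² r_a² / (s_b + t r_a)`. -/
def quadForm (t : ℝ) (ρ σ Y : Matrix n n ℂ) : ℝ :=
  2 * (Yᴴ * ρ).trace.re - (Y * Yᴴ * σ).trace.re - t * (Yᴴ * Y * ρ).trace.re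

/-- In the coordinates `y` the functional decouples into one scalar quadratic per entry, which is
then maximised separately. -/
theorem HasDiag.quadForm_eq {ρ σ U W : Matrix n n ℂ} {r s : n → ℝ} (hρ : HasDiag ρ U r)
    (hσ : HasDiag σ W s) (t : ℝ) (y : Matrix n n ℂ) :
    quadForm t ρ σ (W * y * Uᴴ) = ∑ a, ∑ b,
      (2 * (star (y b a) * (Wᴴ * U) b a).re * r a -
        Complex.normSq (y b a) * (s b + t * r a)) := by
  have h₁ : ((W * y * Uᴴ)ᴴ * ρ).trace =
      (yᴴ * ((Wᴴ * U) * diagonal (fun i => (r i : ℂ)))).trace := by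
    rw [hρ.eq, conjTranspose_mul, conjTranspose_mul, conjTranspose_conjTranspose]
    simp only [Matrix.mul_assoc]
    rw [trace_mul_comm U]
    simp only [Matrix.mul_assoc]
    rw [hρ.left, Matrix.mul_one]
  have h₂ : ((W * y * Uᴴ) * (W * y * Uᴴ)ᴴ * σ).trace =
      (diagonal (fun i => (s i : ℂ)) * (y * yᴴ)).trace := by
    rw [hσ.eq, conjTranspose_mul, conjTranspose_mul, conjTranspose_conjTranspose]
    calc _ = (W * (y * (Uᴴ * U) * yᴴ * (Wᴴ * W) * diagonal (fun i => (s i : ℂ)) * Wᴴ)).trace := by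
          simp only [Matrix.mul_assoc]
      _ = (y * yᴴ * diagonal (fun i => (s i : ℂ)) * (Wᴴ * W)).trace := by
          rw [trace_mul_comm, hρ.left, hσ.left]; simp only [Matrix.mul_assoc,
            Matrix.mul_one, hσ.left]
      _ = _ := by rw [hσ.left, Matrix.mul_one, trace_mul_comm]
  have h₃ : ((W * y * Uᴴ)ᴴ * (W * y * Uᴴ) * ρ).trace =
      (yᴴ * (y * diagonal (fun i => (r i : ℂ)))).trace := by
    rw [hρ.eq, conjTranspose_mul, conjTranspose_mul, conjTranspose_conjTranspose]
    calc _ = (U * (yᴴ * (Wᴴ * W) * y * (Uᴴ * U) * diagonal (fun i => (r i : ℂ)) * Uᴴ)).trace := by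
          simp only [Matrix.mul_assoc]
      _ = (yᴴ * y * diagonal (fun i => (r i : ℂ)) * (Uᴴ * U)).trace := by
          rw [trace_mul_comm, hρ.left, hσ.left]; simp only [Matrix.mul_assoc,
            Matrix.mul_one, hρ.left]
      _ = _ := by rw [hρ.left, Matrix.mul_one, Matrix.mul_assoc]
  have e₁ : ((W * y * Uᴴ)ᴴ * ρ).trace.re =
      ∑ a, ∑ b, (star (y b a) * (Wᴴ * U) b a).re * r a := by
    rw [h₁, trace, Complex.re_sum]
    refine Finset.sum_congr rfl fun a _ => ?_
    rw [diag_apply, Matrix.mul_apply, Complex.re_sum]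
    refine Finset.sum_congr rfl fun b _ => ?_
    rw [mul_diagonal, conjTranspose_apply, ← mul_assoc, Complex.re_mul_ofReal]
  have e₂ : ((W * y * Uᴴ) * (W * y * Uᴴ)ᴴ * σ).trace.re =
      ∑ a, ∑ b, Complex.normSq (y b a) * s b := by
    rw [h₂, trace, Complex.re_sum, Finset.sum_comm]
    refine Finset.sum_congr rfl fun b _ => ?_
    rw [diag_apply, diagonal_mul, Matrix.mul_apply, Complex.re_ofReal_mul, Complex.re_sum,
      Finset.mul_sum]
    refine Finset.sum_congr rfl fun a _ => ?_
    rw [conjTranspose_apply, Complex.star_def, Complex.mul_conj, Complex.ofReal_re, mul_comm]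
  have e₃ : ((W * y * Uᴴ)ᴴ * (W * y * Uᴴ) * ρ).trace.re =
      ∑ a, ∑ b, Complex.normSq (y b a) * r a := by
    rw [h₃, trace, Complex.re_sum]
    refine Finset.sum_congr rfl fun a _ => ?_
    rw [diag_apply, Matrix.mul_apply, Complex.re_sum]
    refine Finset.sum_congr rfl fun b _ => ?_
    rw [mul_diagonal, conjTranspose_apply, ← mul_assoc, Complex.re_mul_ofReal, Complex.star_def,
      ← Complex.normSq_eq_conj_mul_self, Complex.ofReal_re]
  rw [quadForm, e₁, e₂, e₃]
  simp only [Finset.mul_sum, ← Finset.sum_sub_distrib]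
  refine Finset.sum_congr rfl fun a _ => Finset.sum_congr rfl fun b _ => ?_
  ring

theorem HasDiag.quadForm_le {ρ σ U W : Matrix n n ℂ} {r s : n → ℝ} (hρ : HasDiag ρ U r)
    (hσ : HasDiag σ W s) (hr : ∀ a, 0 ≤ r a) (hs : ∀ b, 0 ≤ s b) {t : ℝ} (ht : 0 < t)
    (Y : Matrix n n ℂ) :
    quadForm t ρ σ Y ≤ ∑ a, ∑ b, overlap W U b a * (r a ^ 2 / (s b + t * r a)) := by
  have hY : Y = W * (Wᴴ * Y * U) * Uᴴ := by
    calc Y = (W * Wᴴ) * Y * (U * Uᴴ) := by rw [hσ.right, hρ.right]; simp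
      _ = _ := by simp only [Matrix.mul_assoc]
  rw [hY, hρ.quadForm_eq hσ]
  refine Finset.sum_le_sum fun a _ => Finset.sum_le_sum fun b _ => ?_
  rw [overlap]
  generalize (Wᴴ * Y * U) b a = y
  generalize (Wᴴ * U) b a = u
  have hra := hr a
  have hsb := hs b
  -- A zero denominator forces `r a = 0`, as `t > 0`, and then `x / 0 = 0` is the right value.
  rcases eq_or_lt_of_le (add_nonneg hsb (mul_nonneg ht.le hra)) with h | h
  · have : r a = 0 := by nlinarith
    rw [← h, this]
    simp
  rw [← mul_div_assoc, le_div_iff₀ h]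
  -- Completing the square: the maximiser is `y = u r / (s + t r)`.
  have := Complex.normSq_nonneg (y * ((s b + t * r a : ℝ) : ℂ) - u * ((r a : ℝ) : ℂ))
  simp only [Complex.normSq_apply, Complex.star_def, Complex.mul_re, Complex.mul_im,
    Complex.sub_re, Complex.sub_im, Complex.conj_re, Complex.conj_im, Complex.ofReal_re,
    Complex.ofReal_im] at this ⊢
  linarith

theorem HasDiag.exists_quadForm_eq {ρ σ U W : Matrix n n ℂ} {r s : n → ℝ} (hρ : HasDiag ρ U r)
    (hσ : HasDiag σ W s) (hr : ∀ a, 0 ≤ r a) (hs : ∀ b, 0 ≤ s b) {t : ℝ} (ht : 0 < t) :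
    ∃ Y, quadForm t ρ σ Y =
      ∑ a, ∑ b, overlap W U b a * (r a ^ 2 / (s b + t * r a)) := by
  refine ⟨W * Matrix.of (fun b a => (Wᴴ * U) b a * ((r a / (s b + t * r a) : ℝ) : ℂ)) * Uᴴ, ?_⟩
  rw [hρ.quadForm_eq hσ]
  refine Finset.sum_congr rfl fun a _ => Finset.sum_congr rfl fun b _ => ?_
  rw [overlap, of_apply]
  generalize (Wᴴ * U) b a = u
  have hra := hr a
  have hsb := hs b
  simp only [Complex.normSq_apply, Complex.star_def, Complex.mul_re, Complex.mul_im,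
    Complex.conj_re, Complex.conj_im, Complex.ofReal_re, Complex.ofReal_im]
  rcases eq_or_lt_of_le (add_nonneg hsb (mul_nonneg ht.le hra)) with h | h
  · rw [← h]
    simp
  have hc := h.ne'
  have hcr : (s b + t * r a) * (r a / (s b + t * r a)) = r a := by field_simp
  have e : r a ^ 2 / (s b + t * r a) = r a * (r a / (s b + t * r a)) := by ring
  rw [e]
  generalize r a / (s b + t * r a) = z at *
  linear_combination (-(u.re * u.re + u.im * u.im) * z) * hcr

theorem conjTranspose_blockSum (V : ι → Matrix n m ℂ) (τ : ι → Matrix m m ℂ) :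
    (blockSum V τ)ᴴ = blockSum V (fun i => (τ i)ᴴ) := by
  simp only [blockSum, conjTranspose_sum, conjTranspose_mul, conjTranspose_conjTranspose,
    Matrix.mul_assoc]

theorem trace_blockSum_mul (V : ι → Matrix n m ℂ) (ρ : Matrix n n ℂ) (τ : ι → Matrix m m ℂ) :
    (blockSum V τ * ρ).trace = ∑ i, (τ i * block V ρ i).trace := by
  rw [trace_mul_comm, trace_mul_blockSum]
  exact Finset.sum_congr rfl fun i _ => trace_mul_comm _ _

variable {V : ι → Matrix n m ℂ}

/-- Block-diagonal test operators see only the diagonal blocks, so maximising over all operators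
gives at least the sum of the blockwise maxima. -/
theorem IsBlockFamily.quadForm_blockSum (hV : IsBlockFamily V) (t : ℝ) (ρ σ : Matrix n n ℂ)
    (Y : ι → Matrix m m ℂ) : quadForm t ρ σ (blockSum V Y) =
      ∑ i, quadForm t (block V ρ i) (block V σ i) (Y i) := by
  simp only [quadForm, conjTranspose_blockSum, hV.blockSum_mul, trace_blockSum_mul,
    Complex.re_sum, Finset.mul_sum, Finset.sum_sub_distrib]

/-- By positivity, `⟨V i v, σ V i v⟩ = 0` already forces `σ (V i v) = 0`. -/
theorem kerLE_block {ρ σ : Matrix n n ℂ} (hσ : σ.PosSemidef) (h : KerLE σ ρ) (i : ι) :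
    KerLE (block V σ i) (block V ρ i) := by
  intro v hv
  have h₁ : σ *ᵥ (V i *ᵥ v) = 0 := by
    rw [← hσ.dotProduct_mulVec_zero_iff]
    have := congrArg (fun u => star v ⬝ᵥ u) hv
    simp only [block, dotProduct_zero] at this
    rw [← this, star_mulVec, ← dotProduct_mulVec, mulVec_mulVec, mulVec_mulVec,
      Matrix.mul_assoc]
  rw [block, ← mulVec_mulVec, ← mulVec_mulVec, h _ h₁, mulVec_zero]

/-- Monotonicity of the relative entropy under pinching. -/
theorem IsBlockFamily.sum_qd_block_le (hV : IsBlockFamily V) {ρ σ : Matrix n n ℂ}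
    (hρ : ρ.PosSemidef) (hσ : σ.PosSemidef) (h : KerLE σ ρ) :
    ∑ i, qd (block V ρ i) (block V σ i) ≤ qd ρ σ := by
  obtain ⟨U, r, hU, hr⟩ := exists_hasDiag_of_posSemidef hρ
  obtain ⟨W, s, hW, hs⟩ := exists_hasDiag_of_posSemidef hσ
  choose U' r' hU' hr' using fun i => exists_hasDiag_of_posSemidef (posSemidef_block (V := V) hρ i)
  choose W' s' hW' hs' using fun i => exists_hasDiag_of_posSemidef (posSemidef_block (V := V) hσ i)
  have key := sum_mul_log_le_of_sum_sq_div_le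
    (κ := ι × m × m) (κ' := n × n)
    (w := fun k => overlap (W' k.1) (U' k.1) k.2.2 k.2.1)
    (r := fun k => r' k.1 k.2.1) (s := fun k => s' k.1 k.2.2)
    (w' := fun k => overlap W U k.2 k.1) (r' := fun k => r k.1) (s' := fun k => s k.2)
    (fun k => hr' _ _) (fun k => hs' _ _)
    (fun k hk => (hU' k.1).mul_eq_zero_of_kerLE (hW' k.1) (kerLE_block hσ h k.1) _ _ hk)
    (fun k => hr _) (fun k => hs _) (fun k hk => hU.mul_eq_zero_of_kerLE hW h _ _ hk)
    (fun t ht => ?_) ?_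
  · simp only [Fintype.sum_prod_type] at key
    rw [hU.qd_eq hW]
    refine le_trans (le_of_eq ?_) key
    exact Finset.sum_congr rfl fun i _ => (hU' i).qd_eq (hW' i)
  -- The blockwise maximisers, assembled into one operator, are a competitor for the whole space.
  · choose Y hY using fun i => (hU' i).exists_quadForm_eq (hW' i) (hr' i) (hs' i) ht
    simp only [Fintype.sum_prod_type]
    refine le_trans (le_of_eq ?_) (hU.quadForm_le hW hr hs ht (blockSum V Y))
    rw [hV.quadForm_blockSum]
    exact Finset.sum_congr rfl fun i _ => (hY i).symm
  · simp only [Fintype.sum_prod_type]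
    rw [← hU.trace_left hW, ← hV.sum_trace_block, Complex.re_sum]
    exact Finset.sum_congr rfl fun i _ => ((hU' i).trace_left (hW' i)).symm

theorem isHermitian_block {ρ : Matrix n n ℂ} (hρ : ρ.IsHermitian) (i : ι) :
    (block V ρ i).IsHermitian :=
  isHermitian_conjTranspose_mul_mul (V i) hρ

/-- `Tr ρ log (blockSum V τ)` involves only the blocks of `ρ`, so exchanging `τ` for the blocks of
`ρ` changes it block by block. This is the Pythagorean identity behind both the discord formula and
the upper bound. -/
theorem IsBlockFamily.qd_blockSum_right (hV : IsBlockFamily V) {ρ : Matrix n n ℂ}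
    (hρ : ρ.IsHermitian)
    {τ : ι → Matrix m m ℂ} (hτ : ∀ i, (τ i).IsHermitian) :
    qd ρ (blockSum V τ) = qd ρ (blockSum V (block V ρ)) + ∑ i, qd (block V ρ i) (τ i) := by
  simp only [qd, hV.cfc_blockSum hτ, hV.cfc_blockSum (isHermitian_block hρ), trace_mul_blockSum,
    Complex.re_sum, Finset.sum_sub_distrib]
  ring

end RelativeEntropy

/-! ### Projective measurements as block decompositions -/

section Measurement

variable {X Y : Type*} [Fintype X] [Fintype Y] [DecidableEq X] [DecidableEq Y]

/-- The isometry `x ↦ x ⊗ e i`. -/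
def isoCol (X : Type*) [DecidableEq X] (e : OrthonormalBasis Y ℂ (EuclideanSpace ℂ Y)) (i : Y) :
    Matrix (X × Y) X ℂ :=
  Matrix.of fun z x => if z.1 = x then e i z.2 else 0

variable (e : OrthonormalBasis Y ℂ (EuclideanSpace ℂ Y))

theorem sum_star_mul_basis (i j : Y) : ∑ y, star (e i y) * e j y = if i = j then 1 else 0 := by
  rw [← orthonormal_iff_ite.1 e.orthonormal i j, PiLp.inner_apply]
  exact Finset.sum_congr rfl fun y _ => by
    rw [RCLike.inner_apply, mul_comm]; rfl

theorem sum_basis_mul_star (y y' : Y) : ∑ i, e i y * star (e i y') = if y = y' then 1 else 0 := by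
  have h₁ : (Matrix.of fun y i => e i y)ᴴ * (Matrix.of fun y i => e i y) = 1 := by
    ext i j
    rw [mul_apply, one_apply, ← sum_star_mul_basis e i j]
    rfl
  have h₂ := congrArg (fun M : Matrix Y Y ℂ => M y y') (mul_eq_one_comm.1 h₁)
  dsimp only at h₂
  rw [mul_apply, one_apply] at h₂
  exact h₂

theorem isoCol_mul_mul (i : Y) (τ : Matrix X X ℂ) :
    isoCol X e i * τ * (isoCol X e i)ᴴ = τ ⊗ₖ ketbra (e i) := by
  ext z z'
  simp only [mul_apply, isoCol, of_apply, conjTranspose_apply, ite_mul, zero_mul,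
    Finset.sum_ite_eq, Finset.mem_univ, if_true, kroneckerMap_apply, ketbra, vecMulVec_apply,
    apply_ite star, star_zero, mul_ite, mul_zero]
  ring

theorem isBlockFamily_isoCol : IsBlockFamily (isoCol X e) where
  orth i j := by
    ext x x'
    simp only [mul_apply, isoCol, of_apply, conjTranspose_apply, Fintype.sum_prod_type,
      apply_ite star, star_zero, mul_ite, mul_zero, ite_mul, zero_mul]
    rw [Finset.sum_eq_single x]
    · by_cases h : x = x'
      · subst h
        simp only [if_true, sum_star_mul_basis]
        split_ifs <;> simp
      · simp only [h, if_false, Finset.sum_const_zero]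
        split_ifs <;> simp [h]
    · intro b _ hb
      simp [hb]
    · simp
  complete := by
    have h (i : Y) : isoCol X e i * (isoCol X e i)ᴴ = (1 : Matrix X X ℂ) ⊗ₖ ketbra (e i) := by
      rw [← isoCol_mul_mul, Matrix.mul_one]
    ext z z'
    simp only [h, Matrix.sum_apply, kroneckerMap_apply, ketbra, vecMulVec_apply, ← Finset.mul_sum,
      sum_basis_mul_star, one_apply, Prod.ext_iff, ite_and]
    split_ifs <;> simp

theorem outcome_eq (ρ : Matrix (X × Y) (X × Y) ℂ) (i : Y) :
    outcome e ρ i = block (isoCol X e) ρ i ⊗ₖ ketbra (e i) := by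
  have h : (1 : Matrix X X ℂ) ⊗ₖ ketbra (e i) = isoCol X e i * (isoCol X e i)ᴴ := by
    rw [← isoCol_mul_mul, Matrix.mul_one]
  rw [← isoCol_mul_mul, outcome, h, block]
  simp only [Matrix.mul_assoc]

theorem blockSum_isoCol (τ : Y → Matrix X X ℂ) :
    blockSum (isoCol X e) τ = ∑ i, τ i ⊗ₖ ketbra (e i) := by
  simp only [blockSum, isoCol_mul_mul]

theorem measured_eq (ρ : Matrix (X × Y) (X × Y) ℂ) :
    measured e ρ = blockSum (isoCol X e) (block (isoCol X e) ρ) := by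
  simp only [measured, outcome_eq, blockSum_isoCol]

theorem trace_ketbra (i : Y) : (ketbra (e i)).trace = 1 := by
  have := sum_star_mul_basis e i i
  simp only [if_true] at this
  rw [ketbra, trace_vecMulVec, dotProduct, ← this]
  exact Finset.sum_congr rfl fun y _ => mul_comm _ _

theorem posSemidef_ketbra (v : EuclideanSpace ℂ X) : (ketbra v).PosSemidef :=
  posSemidef_vecMulVec_self_star _

theorem prob_eq (ρ : Matrix (X × Y) (X × Y) ℂ) (i : Y) :
    prob e ρ i = (block (isoCol X e) ρ i).trace.re := by
  rw [prob, outcome_eq, trace_kronecker, trace_ketbra, mul_one]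

theorem partialTrace_outcome (ρ : Matrix (X × Y) (X × Y) ℂ) (i : Y) :
    partialTrace (outcome e ρ i) = block (isoCol X e) ρ i := by
  ext x x'
  have := trace_ketbra e i
  simp only [trace, diag_apply] at this
  simp only [partialTrace, outcome_eq, of_apply, kronecker_apply, ← Finset.mul_sum, this, mul_one]

theorem condState_eq (ρ : Matrix (X × Y) (X × Y) ℂ) (i : Y) :
    condState e ρ i = ((prob e ρ i : ℂ))⁻¹ • block (isoCol X e) ρ i := by
  rw [condState, partialTrace_outcome]

theorem trace_eq_re {A : Matrix X X ℂ} (hA : A.PosSemidef) : A.trace = (A.trace.re : ℂ) := by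
  have h := hA.trace_nonneg
  rw [Complex.le_def] at h
  exact Complex.ext rfl (by simpa using h.2.symm)

theorem trace_re_nonneg {A : Matrix X X ℂ} (hA : A.PosSemidef) : 0 ≤ A.trace.re :=
  (Complex.le_def.1 hA.trace_nonneg).1

theorem eq_zero_of_trace_re {A : Matrix X X ℂ} (hA : A.PosSemidef) (h : A.trace.re = 0) :
    A = 0 := by
  rw [← hA.trace_eq_zero_iff, trace_eq_re hA, h, Complex.ofReal_zero]

theorem prob_nonneg {ρ : Matrix (X × Y) (X × Y) ℂ} (hρ : ρ.PosSemidef) (i : Y) :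
    0 ≤ prob e ρ i := by
  rw [prob_eq]
  exact trace_re_nonneg (posSemidef_block hρ i)

/-- For an outcome of probability zero the block is positive with zero trace, hence zero, so the
identity persists. -/
theorem smul_condState {ρ : Matrix (X × Y) (X × Y) ℂ} (hρ : ρ.PosSemidef) (i : Y) :
    (prob e ρ i : ℂ) • condState e ρ i = block (isoCol X e) ρ i := by
  rw [condState_eq]
  by_cases h : prob e ρ i = 0
  · rw [h]
    rw [prob_eq] at h
    simp [eq_zero_of_trace_re (posSemidef_block hρ i) h]
  · rw [smul_inv_smul₀]
    exact_mod_cast h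

theorem posSemidef_real_smul {A : Matrix X X ℂ} (hA : A.PosSemidef) {c : ℝ} (hc : 0 ≤ c) :
    ((c : ℂ) • A).PosSemidef :=
  hA.smul (Complex.zero_le_real.2 hc)

theorem posSemidef_condState {ρ : Matrix (X × Y) (X × Y) ℂ} (hρ : ρ.PosSemidef) (i : Y) :
    (condState e ρ i).PosSemidef := by
  rw [condState_eq, ← Complex.ofReal_inv]
  exact posSemidef_real_smul (posSemidef_block hρ i) (inv_nonneg.2 (prob_nonneg e hρ i))

theorem condState_eq_zero {ρ : Matrix (X × Y) (X × Y) ℂ} {i : Y} (h : prob e ρ i = 0) :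
    condState e ρ i = 0 := by
  rw [condState_eq, h]; simp

theorem trace_condState {ρ : Matrix (X × Y) (X × Y) ℂ} (hρ : ρ.PosSemidef) {i : Y}
    (h : prob e ρ i ≠ 0) : (condState e ρ i).trace = 1 := by
  rw [condState_eq, trace_smul, trace_eq_re (posSemidef_block hρ i), ← prob_eq, smul_eq_mul,
    inv_mul_cancel₀]
  exact_mod_cast h

theorem measured_eq_sum {ρ : Matrix (X × Y) (X × Y) ℂ} (hρ : ρ.PosSemidef) :
    measured e ρ = ∑ i, (prob e ρ i : ℂ) • (condState e ρ i ⊗ₖ ketbra (e i)) := by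
  rw [measured_eq, blockSum_isoCol]
  exact Finset.sum_congr rfl fun i _ => by rw [← smul_kronecker, smul_condState e hρ]

theorem sum_prob {ρ : Matrix (X × Y) (X × Y) ℂ} (hρ : ρ.trace = 1) : ∑ i, prob e ρ i = 1 := by
  simp only [prob_eq]
  rw [← Complex.re_sum, (isBlockFamily_isoCol e).sum_trace_block, hρ, Complex.one_re]

theorem block_measured (ρ : Matrix (X × Y) (X × Y) ℂ) :
    block (isoCol X e) (measured e ρ) = block (isoCol X e) ρ := by
  rw [measured_eq]
  exact funext fun i => (isBlockFamily_isoCol e).block_blockSum _ i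

theorem isState_measured {ρ : Matrix (X × Y) (X × Y) ℂ} (hρ : IsState ρ) :
    IsState (measured e ρ) := by
  rw [measured_eq]
  refine ⟨posSemidef_blockSum fun i => posSemidef_block hρ.1 i, ?_⟩
  rw [(isBlockFamily_isoCol e).trace_blockSum, (isBlockFamily_isoCol e).sum_trace_block, hρ.2]

theorem exists_isState_smul [Nonempty X] {A : Matrix X X ℂ} (hA : A.PosSemidef) :
    ∃ B, IsState B ∧ A = (A.trace.re : ℂ) • B := by
  by_cases h : A.trace.re = 0
  · refine ⟨((Fintype.card X : ℝ)⁻¹ : ℝ) • 1, ⟨?_, ?_⟩, ?_⟩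
    · exact PosSemidef.one.smul (by positivity)
    · simp [trace_smul, trace_one]
    · simp [eq_zero_of_trace_re hA h]
  · have h' : (A.trace.re : ℂ) ≠ 0 := by exact_mod_cast h
    refine ⟨(A.trace.re : ℂ)⁻¹ • A, ⟨?_, ?_⟩, by rw [smul_inv_smul₀ h']⟩
    · rw [← Complex.ofReal_inv]
      exact posSemidef_real_smul hA (inv_nonneg.2 (trace_re_nonneg hA))
    · rw [trace_smul, smul_eq_mul]
      conv_lhs => rw [trace_eq_re hA]
      exact inv_mul_cancel₀ h'

end Measurement

/-! ### The cone of separable operators -/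

section Separability

variable {X Y : Type*} [Fintype X] [Fintype Y] [DecidableEq X] [DecidableEq Y]

/-- The cone of (unnormalised) separable operators. -/
def sepCone (X Y : Type*) [Fintype X] [Fintype Y] : AddSubmonoid (Matrix (X × Y) (X × Y) ℂ) :=
  AddSubmonoid.closure {σ | ∃ (a : Matrix X X ℂ) (b : Matrix Y Y ℂ),
    a.PosSemidef ∧ b.PosSemidef ∧ σ = a ⊗ₖ b}

theorem kronecker_mem_sepCone {a : Matrix X X ℂ} {b : Matrix Y Y ℂ} (ha : a.PosSemidef)
    (hb : b.PosSemidef) : a ⊗ₖ b ∈ sepCone X Y :=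
  AddSubmonoid.subset_closure ⟨a, b, ha, hb, rfl⟩

/-- To map the separable cone into an additive submonoid it suffices to map products. -/
theorem sepCone_induction {M : Type*} [AddCommMonoid M] (K : AddSubmonoid M)
    (f : Matrix (X × Y) (X × Y) ℂ →+ M)
    (hf : ∀ a b, a.PosSemidef → b.PosSemidef → f (a ⊗ₖ b) ∈ K) {σ : Matrix (X × Y) (X × Y) ℂ}
    (hσ : σ ∈ sepCone X Y) : f σ ∈ K := by
  have : sepCone X Y ≤ K.comap f := by
    refine (AddSubmonoid.closure_le).2 ?_
    rintro _ ⟨a, b, ha, hb, rfl⟩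
    exact hf a b ha hb
  exact this hσ

/-- The cone of positive semidefinite matrices. -/
def psdCone (X : Type*) : AddSubmonoid (Matrix X X ℂ) where
  carrier := {A | A.PosSemidef}
  add_mem' := PosSemidef.add
  zero_mem' := PosSemidef.zero

theorem posSemidef_of_mem_sepCone {σ : Matrix (X × Y) (X × Y) ℂ} (hσ : σ ∈ sepCone X Y) :
    σ.PosSemidef :=
  sepCone_induction (psdCone (X × Y)) (AddMonoidHom.id _) (fun _ _ ha hb => ha.kronecker hb) hσ

theorem smul_mem_sepCone {c : ℝ} (hc : 0 ≤ c) {σ : Matrix (X × Y) (X × Y) ℂ}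
    (hσ : σ ∈ sepCone X Y) : (c : ℂ) • σ ∈ sepCone X Y :=
  sepCone_induction (sepCone X Y) (DistribSMul.toAddMonoidHom _ (c : ℂ))
    (fun a b ha hb => by
      change (c : ℂ) • (a ⊗ₖ b) ∈ _
      rw [← smul_kronecker]
      exact kronecker_mem_sepCone (posSemidef_real_smul ha hc) hb) hσ

/-- Passing to a cone leaves the trace as the only normalisation, and additive maps need then be
checked only on products of positive operators. -/
theorem isSeparable_iff {σ : Matrix (X × Y) (X × Y) ℂ} :
    IsSeparable σ ↔ σ ∈ sepCone X Y ∧ σ.trace = 1 := by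
  constructor
  · rintro ⟨k, p, a, b, hp, hp1, ha, hb, rfl⟩
    refine ⟨sum_mem fun i _ => smul_mem_sepCone (hp i)
      (kronecker_mem_sepCone (ha i).1 (hb i).1), ?_⟩
    simp only [trace_sum, trace_smul, trace_kronecker, (ha _).2, (hb _).2, mul_one, smul_eq_mul]
    exact_mod_cast hp1
  · rintro ⟨hσ, htr⟩
    have hne : Nonempty (X × Y) := by
      by_contra h
      rw [not_nonempty_iff] at h
      simp [trace] at htr
    have : Nonempty X := hne.map Prod.fst
    have : Nonempty Y := hne.map Prod.snd
    obtain ⟨l, hl, rfl⟩ := AddSubmonoid.exists_list_of_mem_closure hσ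
    choose a b ha hb hab using fun i : Fin l.length => hl l[i] (List.getElem_mem _)
    choose a' ha' haa' using fun i => exists_isState_smul (ha i)
    choose b' hb' hbb' using fun i => exists_isState_smul (hb i)
    have hsum : l.sum = ∑ i, (((a i).trace.re * (b i).trace.re : ℝ) : ℂ) • (a' i ⊗ₖ b' i) := by
      have : l.sum = ∑ i : Fin l.length, l[i] := by simp
      rw [this]
      refine Finset.sum_congr rfl fun i _ => ?_
      rw [hab i]
      conv_lhs => rw [haa' i, hbb' i]
      rw [smul_kronecker, kronecker_smul, smul_smul, Complex.ofReal_mul]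
    refine ⟨l.length, fun i => (a i).trace.re * (b i).trace.re, a', b',
      fun i => mul_nonneg (trace_re_nonneg (ha i)) (trace_re_nonneg (hb i)), ?_, ha', hb', hsum⟩
    rw [hsum] at htr
    simp only [trace_sum, trace_smul, trace_kronecker, (ha' _).2, (hb' _).2, mul_one,
      smul_eq_mul] at htr
    exact_mod_cast htr

end Separability

/-! ### Invariance under relabelling of the indices -/

section Reindexing

variable {n l : Type*} [Fintype n] [DecidableEq n] [Fintype l] [DecidableEq l]

theorem trace_submatrix_equiv (e : l ≃ n) (A : Matrix n n ℂ) :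
    (A.submatrix e e).trace = A.trace :=
  Equiv.sum_comp e fun i => A i i

theorem cfc_submatrix_equiv (e : l ≃ n) (A : Matrix n n ℂ) (f : ℝ → ℝ) :
    cfc f (A.submatrix e e) = (cfc f A).submatrix e e := by
  by_cases hA : A.IsHermitian
  · exact cfc_submatrix e hA f
  -- Outside the Hermitian matrices both functional calculi take the default value zero.
  · have hA' : ¬ (A.submatrix e e).IsHermitian := fun h => hA (by
      simpa using h.submatrix e.symm)
    rw [cfc_apply_of_not_predicate (p := IsSelfAdjoint) A hA,
      cfc_apply_of_not_predicate (p := IsSelfAdjoint) _ hA', submatrix_zero]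
    rfl

theorem kerLE_submatrix_equiv (e : l ≃ n) (ρ σ : Matrix n n ℂ) :
    KerLE (σ.submatrix e e) (ρ.submatrix e e) ↔ KerLE σ ρ := by
  have h (A : Matrix n n ℂ) (v : n → ℂ) : A.submatrix e e *ᵥ (v ∘ e) = (A *ᵥ v) ∘ e := by
    rw [submatrix_mulVec_equiv]
    congr 2; ext i; simp
  have h0 (v : n → ℂ) : v ∘ e = 0 ↔ v = 0 := by
    constructor
    · intro h; ext i; simpa using congrFun h (e.symm i)
    · rintro rfl; rfl
  constructor
  · intro H v hv
    rw [← h0, ← h]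
    exact H _ (by rw [h, hv]; rfl)
  · intro H v hv
    have hv' : v = (v ∘ e.symm) ∘ e := by ext i; simp
    rw [hv', h, h0] at hv ⊢
    exact H _ hv

theorem relEntropy_submatrix_equiv (e : l ≃ n) (ρ σ : Matrix n n ℂ) :
    relEntropy (ρ.submatrix e e) (σ.submatrix e e) = relEntropy ρ σ := by
  by_cases h : KerLE σ ρ
  · rw [relEntropy_of_kerLE h, relEntropy_of_kerLE ((kerLE_submatrix_equiv e ρ σ).2 h), qd, qd]
    simp only [cfc_submatrix_equiv, submatrix_mul_equiv, trace_submatrix_equiv]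
  · rw [relEntropy_of_not_kerLE h,
      relEntropy_of_not_kerLE fun h' => h ((kerLE_submatrix_equiv e ρ σ).1 h')]

end Reindexing

/-! ### Relative entropy distance to a cone -/

section ConeEntropy

variable {n : Type*} [Fintype n] [DecidableEq n]

/-- The relative entropy distance to the normalised elements of a cone. -/
def coneEntropy (K : AddSubmonoid (Matrix n n ℂ)) (ρ : Matrix n n ℂ) : EReal :=
  ⨅ (σ : Matrix n n ℂ) (_ : σ ∈ K ∧ σ.trace = 1), relEntropy ρ σ

theorem ree_eq_coneEntropy {X Y : Type*} [Fintype X] [Fintype Y] [DecidableEq X] [DecidableEq Y]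
    (ρ : Matrix (X × Y) (X × Y) ℂ) : ree ρ = coneEntropy (sepCone X Y) ρ := by
  simp only [ree, coneEntropy, isSeparable_iff]

/-- The reindexing of matrices along an equivalence, as an additive map. -/
def submatrixHom {l : Type*} (e : l ≃ n) : Matrix n n ℂ →+ Matrix l l ℂ where
  toFun A := A.submatrix e e
  map_zero' := rfl
  map_add' _ _ := rfl

/-- Both cuts are carried back to the index type of `ρ`, where the measurement of the last system
acts. -/
theorem coneEntropy_submatrix {l : Type*} [Fintype l] [DecidableEq l] (e : l ≃ n)
    (K : AddSubmonoid (Matrix l l ℂ)) (ρ : Matrix n n ℂ) :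
    coneEntropy K (ρ.submatrix e e) = coneEntropy (K.comap (submatrixHom e)) ρ := by
  unfold coneEntropy
  refine (Equiv.iInf_congr (reindex e.symm e.symm) fun σ => ?_).symm
  have : reindex e.symm e.symm σ = σ.submatrix e e := rfl
  rw [this]
  refine iInf_congr_Prop ?_ fun _ => relEntropy_submatrix_equiv e ρ σ
  rw [trace_submatrix_equiv]
  rfl

end ConeEntropy

/-! ### Kernel inclusions -/

section Kernels

variable {n m ι : Type*} [Fintype n] [DecidableEq n] [Fintype m] [DecidableEq m]
  [Fintype ι] [DecidableEq ι] {V : ι → Matrix n m ℂ}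

theorem kerLE_refl (ρ : Matrix n n ℂ) : KerLE ρ ρ := fun _ h => h

theorem KerLE.smul_smul {σ ρ : Matrix n n ℂ} (h : KerLE σ ρ) (p : ℂ) :
    KerLE (p • σ) (p • ρ) := by
  intro v hv
  rcases eq_or_ne p 0 with rfl | hp
  · simp
  · rw [smul_mulVec, smul_eq_zero_iff_right hp] at hv
    rw [smul_mulVec, h v hv, smul_zero]

theorem KerLE.smul_left {σ ρ : Matrix n n ℂ} (h : KerLE σ ρ) {p : ℂ} (hp : p ≠ 0) :
    KerLE (p • σ) ρ := by
  intro v hv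
  rw [smul_mulVec, smul_eq_zero_iff_right hp] at hv
  exact h v hv

theorem kerLE_one (ρ : Matrix n n ℂ) : KerLE 1 ρ := by
  intro v hv
  rw [one_mulVec] at hv
  rw [hv, mulVec_zero]

theorem eq_zero_of_kerLE_zero {ρ : Matrix n n ℂ} (h : KerLE 0 ρ) : ρ = 0 := by
  ext i j
  have := congrFun (h (Pi.single j 1) (zero_mulVec _)) i
  simpa using this

/-- If the block sum kills `v`, each `τ i` kills `(V i)ᴴ v`; by positivity `ρ` kills `V i (V i)ᴴ v`,
and these vectors add up to `v`. -/
theorem IsBlockFamily.kerLE_blockSum (hV : IsBlockFamily V) {ρ : Matrix n n ℂ}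
    (hρ : ρ.PosSemidef) {τ : ι → Matrix m m ℂ} (h : ∀ i, KerLE (τ i) (block V ρ i)) :
    KerLE (blockSum V τ) ρ := by
  intro v hv
  have h₁ (i : ι) : (V i)ᴴ * blockSum V τ = τ i * (V i)ᴴ := by
    simp only [blockSum, Matrix.mul_sum, ← Matrix.mul_assoc, hV.orth]
    rw [Finset.sum_eq_single i]
    · simp
    · intro j _ hj
      simp [Ne.symm hj]
    · simp
  have h₂ (i : ι) : ρ *ᵥ (V i *ᵥ ((V i)ᴴ *ᵥ v)) = 0 := by
    have h₃ : τ i *ᵥ ((V i)ᴴ *ᵥ v) = 0 := by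
      rw [mulVec_mulVec, ← h₁, ← mulVec_mulVec, hv, mulVec_zero]
    have h₄ := congrArg (fun u => star ((V i)ᴴ *ᵥ v) ⬝ᵥ u) (h i _ h₃)
    rw [← hρ.dotProduct_mulVec_zero_iff]
    simp only [block, dotProduct_zero] at h₄
    rw [← h₄, star_mulVec (V i), ← dotProduct_mulVec, mulVec_mulVec, mulVec_mulVec, mulVec_mulVec]
  have h₅ : v = ∑ i, V i *ᵥ ((V i)ᴴ *ᵥ v) := by
    simp only [mulVec_mulVec]
    rw [← sum_mulVec, hV.complete, one_mulVec]
  rw [h₅, mulVec_sum]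
  exact Finset.sum_eq_zero fun i _ => h₂ i

end Kernels

/-! ### Two-sided bounds for the distance to a cone -/

section ConeBounds

variable {n m ι : Type*} [Fintype n] [DecidableEq n] [Fintype m] [DecidableEq m]
  [Fintype ι] [DecidableEq ι]

theorem log_two_pos : 0 < Real.log 2 := Real.log_pos one_lt_two

/-- Cones of positive semidefinite operators containing the identity. -/
structure IsPosCone (K : AddSubmonoid (Matrix n n ℂ)) : Prop where
  psd : ∀ σ ∈ K, σ.PosSemidef
  smul_mem : ∀ (c : ℝ), 0 ≤ c → ∀ σ ∈ K, (c : ℂ) • σ ∈ K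
  one_mem : 1 ∈ K

theorem coneEntropy_le {K : AddSubmonoid (Matrix n n ℂ)} {ρ σ : Matrix n n ℂ} (hσ : σ ∈ K)
    (htr : σ.trace = 1) (h : KerLE σ ρ) :
    coneEntropy K ρ ≤ ((qd ρ σ / Real.log 2 : ℝ) : EReal) := by
  rw [← relEntropy_of_kerLE h]
  exact iInf₂_le σ ⟨hσ, htr⟩

theorem le_coneEntropy {K : AddSubmonoid (Matrix n n ℂ)} {ρ : Matrix n n ℂ} {x : ℝ}
    (h : ∀ σ ∈ K, σ.trace = 1 → KerLE σ ρ → x ≤ qd ρ σ / Real.log 2) :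
    (x : EReal) ≤ coneEntropy K ρ := by
  refine le_iInf₂ fun σ hσ => ?_
  by_cases hk : KerLE σ ρ
  · rw [relEntropy_of_kerLE hk, EReal.coe_le_coe_iff]
    exact h σ hσ.1 hσ.2 hk
  · rw [relEntropy_of_not_kerLE hk]
    exact le_top

theorem exists_lt_of_coneEntropy_lt {K : AddSubmonoid (Matrix n n ℂ)} {ρ : Matrix n n ℂ} {x : ℝ}
    (h : coneEntropy K ρ < x) :
    ∃ σ ∈ K, σ.trace = 1 ∧ KerLE σ ρ ∧ qd ρ σ / Real.log 2 < x := by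
  obtain ⟨σ, hσ⟩ := iInf_lt_iff.1 h
  obtain ⟨⟨hK, htr⟩, hlt⟩ := iInf_lt_iff.1 hσ
  by_cases hk : KerLE σ ρ
  · rw [relEntropy_of_kerLE hk, EReal.coe_lt_coe_iff] at hlt
    exact ⟨σ, hK, htr, hk, hlt⟩
  · rw [relEntropy_of_not_kerLE hk] at hlt
    exact absurd hlt (not_lt.2 le_top)

/-- The normalised identity has trivial kernel and bounds the infimum above; Klein's inequality
bounds it below. The case `ρ = 0` serves the conditional states of outcomes of probability zero. -/
theorem IsPosCone.exists_coneEntropy_eq [Nonempty n] {K : AddSubmonoid (Matrix n n ℂ)}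
    (hK : IsPosCone K) {ρ : Matrix n n ℂ} (hρ : ρ.PosSemidef) (h : ρ = 0 ∨ ρ.trace = 1) :
    ∃ x : ℝ, 0 ≤ x ∧ coneEntropy K ρ = x := by
  have hc : (0 : ℝ) < (Fintype.card n : ℝ)⁻¹ := by positivity
  have h₁ : (((Fintype.card n : ℝ)⁻¹ : ℝ) : ℂ) • (1 : Matrix n n ℂ) ∈ K :=
    hK.smul_mem _ hc.le _ hK.one_mem
  have h₂ := coneEntropy_le h₁ (by simp [trace_smul, trace_one])
    ((kerLE_one ρ).smul_left (by exact_mod_cast hc.ne'))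
  have h₃ : ((0 : ℝ) : EReal) ≤ coneEntropy K ρ := by
    refine le_coneEntropy fun σ hσ htr hk => div_nonneg ?_ log_two_pos.le
    rcases h with rfl | h
    · rw [qd_zero_left]
    · have := trace_sub_trace_le_qd hρ (hK.psd σ hσ) hk
      rwa [h, htr, sub_self] at this
  lift coneEntropy K ρ to ℝ using
    ⟨ne_of_lt (h₂.trans_lt (EReal.coe_lt_top _)),
      ne_of_gt ((EReal.bot_lt_coe 0).trans_le h₃)⟩ with x
  exact ⟨x, EReal.coe_le_coe_iff.1 h₃, rfl⟩

/-- Cones on the total space and on the blocks which are compatible with a block family. -/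
structure IsBlockCone (V : ι → Matrix n m ℂ) (K : AddSubmonoid (Matrix n n ℂ))
    (L : AddSubmonoid (Matrix m m ℂ)) : Prop where
  big : IsPosCone K
  small : IsPosCone L
  block_mem : ∀ σ ∈ K, ∀ i, block V σ i ∈ L
  lift_mem : ∀ τ ∈ L, ∀ i, V i * τ * (V i)ᴴ ∈ K

variable {V : ι → Matrix n m ℂ} {K : AddSubmonoid (Matrix n n ℂ)}
  {L : AddSubmonoid (Matrix m m ℂ)}

/-- Pinching reduces to blocks `p i • c i` against `q i • σ i` with `σ i ∈ L` normalised. Each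
contributes `p i` times a relative entropy plus `p i log (p i / q i) ≥ p i - q i`, and these
differences sum to zero. -/
theorem IsBlockCone.sum_le_qd (hV : IsBlockFamily V) (hK : IsBlockCone V K L)
    {ρ σ : Matrix n n ℂ} (hρ : ρ.PosSemidef) (hρ1 : ρ.trace = 1) {p : ι → ℝ}
    {c : ι → Matrix m m ℂ} (hp : ∀ i, 0 ≤ p i) (hc : ∀ i, (c i).PosSemidef)
    (hc1 : ∀ i, p i ≠ 0 → (c i).trace = 1) (hpc : ∀ i, (p i : ℂ) • c i = block V ρ i)
    {x : ι → ℝ} (hx : ∀ i, coneEntropy L (c i) = x i)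
    (hσ : σ ∈ K) (hσ1 : σ.trace = 1) (hk : KerLE σ ρ) :
    ∑ i, p i * x i ≤ qd ρ σ / Real.log 2 := by
  have hσp := hK.big.psd σ hσ
  have hpt (i : ι) : (block V ρ i).trace.re = p i := by
    rw [← hpc, trace_smul]
    rcases eq_or_ne (p i) 0 with h | h
    · simp [h]
    · rw [hc1 i h]; simp
  have hsum : ∑ i, (p i - (block V σ i).trace.re) = 0 := by
    simp only [← hpt, Finset.sum_sub_distrib]
    rw [← Complex.re_sum, ← Complex.re_sum, hV.sum_trace_block, hV.sum_trace_block, hρ1, hσ1,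
      sub_self]
  have key (i : ι) : Real.log 2 * (p i * x i) + (p i - (block V σ i).trace.re) ≤
      qd (block V ρ i) (block V σ i) := by
    have hq := trace_re_nonneg (posSemidef_block (V := V) hσp i)
    have hki := kerLE_block (V := V) hσp hk i
    rcases eq_or_lt_of_le (hp i) with h | h
    · rw [← hpc, ← h]
      simpa [qd_zero_left] using hq
    -- If `q i = 0`, the kernel inclusion makes the block of `ρ` vanish, contradicting `p i > 0`.
    rcases eq_or_lt_of_le hq with h' | h'
    · rw [eq_zero_of_trace_re (posSemidef_block hσp i) h'.symm] at hki
      have := hpt i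
      rw [eq_zero_of_kerLE_zero hki, trace_zero, Complex.zero_re] at this
      exact absurd this h.ne
    set q := (block V σ i).trace.re with hqdef
    have hq0 : (q : ℂ) ≠ 0 := by exact_mod_cast h'.ne'
    have hp0 : (p i : ℂ) ≠ 0 := by exact_mod_cast h.ne'
    have hs : (q : ℂ) • ((q⁻¹ : ℝ) : ℂ) • block V σ i = block V σ i := by
      rw [Complex.ofReal_inv, smul_inv_smul₀ hq0]
    have hmem : ((q⁻¹ : ℝ) : ℂ) • block V σ i ∈ L :=
      hK.small.smul_mem _ (inv_nonneg.2 hq) _ (hK.block_mem σ hσ i)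
    have htr : (((q⁻¹ : ℝ) : ℂ) • block V σ i).trace = 1 := by
      rw [trace_smul, trace_eq_re (posSemidef_block hσp i), ← hqdef, Complex.ofReal_inv,
        smul_eq_mul, inv_mul_cancel₀ hq0]
    have hkc : KerLE (((q⁻¹ : ℝ) : ℂ) • block V σ i) (c i) := by
      have h₁ : KerLE (block V σ i) (c i) := by
        intro v hv
        have := hki v hv
        rwa [← hpc, smul_mulVec, smul_eq_zero_iff_right hp0] at this
      exact h₁.smul_left (by exact_mod_cast inv_ne_zero h'.ne')
    have h₂ := coneEntropy_le hmem htr hkc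
    rw [hx, EReal.coe_le_coe_iff, le_div_iff₀ log_two_pos] at h₂
    have h₃ := qd_smul_smul (hc i) (hK.small.psd _ hmem) hkc (p := p i) h'
    rw [hs, hpc, hc1 i h.ne', Complex.one_re, mul_one] at h₃
    rw [h₃]
    have h₄ := Real.log_le_sub_one_of_pos (div_pos h' h)
    rw [Real.log_div h'.ne' h.ne'] at h₄
    have h₅ : q / p i * p i = q := by field_simp
    nlinarith
  rw [le_div_iff₀ log_two_pos]
  refine le_trans ?_ (hV.sum_qd_block_le hρ hσp hk)
  refine le_trans (le_of_eq ?_) (Finset.sum_le_sum fun i _ => key i)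
  rw [Finset.sum_add_distrib, hsum, add_zero, ← Finset.mul_sum, mul_comm]

/-- The witness weights elements of `L`, each within `ε` of its infimum, by the outcome
probabilities; the total error is at most `∑ p i ε = ε`. Working with `ε` avoids showing that the
infima are attained. -/
theorem IsBlockCone.exists_qd_le (hV : IsBlockFamily V) (hK : IsBlockCone V K L)
    {ρ : Matrix n n ℂ} (hρ : ρ.PosSemidef) {p : ι → ℝ}
    {c : ι → Matrix m m ℂ} (hp : ∀ i, 0 ≤ p i) (hp1 : ∑ i, p i = 1)
    (hc : ∀ i, (c i).PosSemidef) (hpc : ∀ i, (p i : ℂ) • c i = block V ρ i)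
    {x : ι → ℝ} (hx : ∀ i, coneEntropy L (c i) = x i) {ε : ℝ} (hε : 0 < ε) :
    ∃ σ ∈ K, σ.trace = 1 ∧ KerLE σ ρ ∧ qd ρ σ / Real.log 2 ≤
      qd ρ (blockSum V (block V ρ)) / Real.log 2 + ∑ i, p i * x i + ε := by
  have hlt (i : ι) : coneEntropy L (c i) < ((x i + ε : ℝ) : EReal) := by
    rw [hx, EReal.coe_lt_coe_iff]
    linarith
  choose τ hτ hτ1 hτk hτx using fun i => exists_lt_of_coneEntropy_lt (hlt i)
  have hpsd (i : ι) := hK.small.psd _ (hτ i)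
  refine ⟨blockSum V fun i => (p i : ℂ) • τ i, ?_, ?_, ?_, ?_⟩
  · exact sum_mem fun i _ => hK.lift_mem _ (hK.small.smul_mem _ (hp i) _ (hτ i)) i
  · rw [hV.trace_blockSum]
    simp only [trace_smul, hτ1, smul_eq_mul, mul_one]
    exact_mod_cast hp1
  · refine hV.kerLE_blockSum hρ fun i => ?_
    rw [← hpc]
    exact (hτk i).smul_smul _
  · rw [hV.qd_blockSum_right hρ.isHermitian
      fun i => (posSemidef_real_smul (hpsd i) (hp i)).isHermitian, add_div, add_assoc]
    refine add_le_add_right ?_ _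
    have key (i : ι) : qd (block V ρ i) ((p i : ℂ) • τ i) ≤
        Real.log 2 * (p i * x i + p i * ε) := by
      rw [← hpc]
      rcases eq_or_lt_of_le (hp i) with h | h
      · simp [← h, qd_zero_left]
      · have h₁ := hτx i
        rw [div_lt_iff₀ log_two_pos] at h₁
        rw [qd_smul_smul (hc i) (hpsd i) (hτk i) h, sub_self, zero_mul, add_zero]
        nlinarith
    rw [div_le_iff₀ log_two_pos]
    refine (Finset.sum_le_sum fun i _ => key i).trans (le_of_eq ?_)
    rw [← Finset.mul_sum, Finset.sum_add_distrib, ← Finset.sum_mul, hp1]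
    ring

end ConeBounds

/-! ### Discord as the minimal entropy increase -/

section Discord

variable {X Y : Type*} [Fintype X] [Fintype Y] [DecidableEq X] [DecidableEq Y]

theorem nonempty_of_isState {ρ : Matrix X X ℂ} (hρ : IsState ρ) : Nonempty X := by
  by_contra h
  rw [not_nonempty_iff] at h
  simpa [trace] using hρ.2

theorem isQuantumClassical_measured (e : OrthonormalBasis Y ℂ (EuclideanSpace ℂ Y))
    {ρ : Matrix (X × Y) (X × Y) ℂ} (hρ : IsState ρ) : IsQuantumClassical (measured e ρ) := by
  have : Nonempty X := (nonempty_of_isState hρ).map Prod.fst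
  choose τ hτ hτ' using fun i => exists_isState_smul (posSemidef_block (V := isoCol X e) hρ.1 i)
  refine ⟨e, prob e ρ, τ, prob_nonneg e hρ.1, sum_prob e hρ.2, hτ, ?_⟩
  rw [measured_eq, blockSum_isoCol]
  exact Finset.sum_congr rfl fun i _ => by
    rw [← smul_kronecker, prob_eq, ← hτ']

theorem kerLE_measured (e : OrthonormalBasis Y ℂ (EuclideanSpace ℂ Y))
    {ρ : Matrix (X × Y) (X × Y) ℂ} (hρ : ρ.PosSemidef) : KerLE (measured e ρ) ρ := by
  rw [measured_eq]
  exact (isBlockFamily_isoCol e).kerLE_blockSum hρ fun i => kerLE_refl _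

/-- `log Π(ρ)` is block-diagonal, so `Tr ρ log Π(ρ) = Tr Π(ρ) log Π(ρ)`. -/
theorem qd_measured (e : OrthonormalBasis Y ℂ (EuclideanSpace ℂ Y))
    {ρ : Matrix (X × Y) (X × Y) ℂ} (hρ : ρ.PosSemidef) :
    qd ρ (measured e ρ) / Real.log 2 = entropy (measured e ρ) - entropy ρ := by
  have hV := isBlockFamily_isoCol (X := X) e
  have h := fun i => isHermitian_block (V := isoCol X e) hρ.isHermitian i
  rw [measured_eq, qd, entropy, entropy, hV.cfc_blockSum h, hV.blockSum_mul, hV.trace_blockSum,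
    trace_mul_blockSum]
  ring

theorem discord_le (e : OrthonormalBasis Y ℂ (EuclideanSpace ℂ Y))
    {ρ : Matrix (X × Y) (X × Y) ℂ} (hρ : IsState ρ) :
    discord ρ ≤ ((entropy (measured e ρ) - entropy ρ : ℝ) : EReal) := by
  rw [← qd_measured e hρ.1, ← relEntropy_of_kerLE (kerLE_measured e hρ.1)]
  exact iInf₂_le _ (isQuantumClassical_measured e hρ)

/-- A quantum-classical `χ` is block-diagonal in its own basis `f`. The block identity splits off
the entropy increase for `f`, at least the optimal one, and Klein's inequality bounds the rest below
by `∑ (prob f ρ j - p j) = 0`. -/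
theorem discord_eq {e : OrthonormalBasis Y ℂ (EuclideanSpace ℂ Y)}
    {ρ : Matrix (X × Y) (X × Y) ℂ} (hρ : IsState ρ) (he : IsOptimal e ρ) :
    discord ρ = ((entropy (measured e ρ) - entropy ρ : ℝ) : EReal) := by
  refine le_antisymm (discord_le e hρ) (le_iInf₂ fun χ hχ => ?_)
  obtain ⟨f, p, τ, hp, hp1, hτ, rfl⟩ := hχ
  have hV := isBlockFamily_isoCol (X := X) f
  have hχ : ∑ j, (p j : ℂ) • (τ j ⊗ₖ ketbra (f j)) =
      blockSum (isoCol X f) fun j => (p j : ℂ) • τ j := by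
    simp only [blockSum_isoCol, smul_kronecker]
  rw [hχ]
  by_cases hk : KerLE (blockSum (isoCol X f) fun j => (p j : ℂ) • τ j) ρ
  swap
  · rw [relEntropy_of_not_kerLE hk]
    exact le_top
  rw [relEntropy_of_kerLE hk, EReal.coe_le_coe_iff]
  refine (he f).trans ?_
  have hpsd (j : Y) := posSemidef_real_smul (hτ j).1 (hp j)
  rw [← qd_measured f hρ.1, hV.qd_blockSum_right hρ.1.isHermitian fun j => (hpsd j).isHermitian,
    measured_eq]
  refine div_le_div_of_nonneg_right (le_add_of_nonneg_right ?_) log_two_pos.le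
  have key (j : Y) : prob f ρ j - p j ≤ qd (block (isoCol X f) ρ j) ((p j : ℂ) • τ j) := by
    have h₁ := kerLE_block (V := isoCol X f) (posSemidef_blockSum hpsd) hk j
    rw [hV.block_blockSum] at h₁
    have h₂ := trace_sub_trace_le_qd (posSemidef_block hρ.1 j) (hpsd j) h₁
    rwa [← prob_eq, trace_smul, (hτ j).2, smul_eq_mul, mul_one, Complex.ofReal_re] at h₂
  refine le_trans (le_of_eq ?_) (Finset.sum_le_sum fun j _ => key j)
  rw [Finset.sum_sub_distrib, sum_prob f hρ.2, hp1, sub_self]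

end Discord

/-! ### The cuts `A : CB` and `AC : B` -/

section Cuts

variable {A B C : Type*} [Fintype A] [Fintype B] [Fintype C]
  [DecidableEq A] [DecidableEq B] [DecidableEq C]

/-- The regrouping `A : CB` of the three systems. -/
def equivA (A B C : Type*) : A × (C × B) ≃ (A × B) × C where
  toFun x := ((x.1, x.2.2), x.2.1)
  invFun x := (x.1.1, (x.2, x.1.2))
  left_inv _ := rfl
  right_inv _ := rfl

/-- The regrouping `AC : B` of the three systems. -/
def equivB (A B C : Type*) : (A × C) × B ≃ (A × B) × C where
  toFun x := ((x.1.1, x.2), x.1.2)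
  invFun x := ((x.1.1, x.2), x.1.2)
  left_inv _ := rfl
  right_inv _ := rfl

/-- Operators on `ABC` separable in the cut `A : CB`. -/
def coneA (A B C : Type*) [Fintype A] [Fintype B] [Fintype C] :
    AddSubmonoid (Matrix ((A × B) × C) ((A × B) × C) ℂ) :=
  (sepCone A (C × B)).comap (submatrixHom (equivA A B C))

/-- Operators on `ABC` separable in the cut `AC : B`. -/
def coneB (A B C : Type*) [Fintype A] [Fintype B] [Fintype C] :
    AddSubmonoid (Matrix ((A × B) × C) ((A × B) × C) ℂ) :=
  (sepCone (A × C) B).comap (submatrixHom (equivB A B C))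

theorem reeA_eq (ρ : Matrix ((A × B) × C) ((A × B) × C) ℂ) :
    reeA ρ = coneEntropy (coneA A B C) ρ := by
  rw [reeA, ree_eq_coneEntropy]
  exact coneEntropy_submatrix (equivA A B C) _ ρ

theorem reeB_eq (ρ : Matrix ((A × B) × C) ((A × B) × C) ℂ) :
    reeB ρ = coneEntropy (coneB A B C) ρ := by
  rw [reeB, ree_eq_coneEntropy]
  exact coneEntropy_submatrix (equivB A B C) _ ρ

theorem isPosCone_sepCone : IsPosCone (sepCone A B) where
  psd _ h := posSemidef_of_mem_sepCone h
  smul_mem _ hc _ h := smul_mem_sepCone hc h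
  one_mem := by
    rw [← one_kronecker_one]
    exact kronecker_mem_sepCone PosSemidef.one PosSemidef.one

theorem IsPosCone.comap_submatrixHom {n l : Type*} [Fintype n] [DecidableEq n] [Fintype l]
    [DecidableEq l] {K : AddSubmonoid (Matrix l l ℂ)} (hK : IsPosCone K) (e : l ≃ n) :
    IsPosCone (K.comap (submatrixHom e)) where
  psd σ h := (posSemidef_submatrix_equiv e).1 (hK.psd _ h)
  smul_mem c hc σ h := hK.smul_mem c hc _ h
  one_mem := by
    change (1 : Matrix n n ℂ).submatrix e e ∈ K
    rw [submatrix_one_equiv]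
    exact hK.one_mem

theorem block_isoCol_apply {X : Type*} [Fintype X] [DecidableEq X]
    (e : OrthonormalBasis C ℂ (EuclideanSpace ℂ C)) (ρ : Matrix (X × C) (X × C) ℂ) (i : C)
    (x x' : X) : block (isoCol X e) ρ i x x' =
      ∑ c', ∑ c, star (e i c) * ρ (x, c) (x', c') * e i c' := by
  simp only [block, mul_apply, isoCol, of_apply, conjTranspose_apply, Fintype.sum_prod_type,
    apply_ite star, star_zero, ite_mul, zero_mul, mul_ite, mul_zero, Finset.sum_mul]
  rw [Finset.sum_eq_single x']
  · refine Finset.sum_congr rfl fun c' _ => ?_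
    rw [Finset.sum_eq_single x]
    · simp
    · intro y _ hy; simp [hy]
    · simp
  · intro y _ hy; simp [hy]
  · simp

/-- Taking a block, as an additive map. -/
def blockHom {n m ι : Type*} [Fintype n] (V : ι → Matrix n m ℂ) (i : ι) :
    Matrix n n ℂ →+ Matrix m m ℂ where
  toFun ρ := block V ρ i
  map_zero' := by simp [block]
  map_add' ρ σ := by simp [block, Matrix.mul_add, Matrix.add_mul]

/-- Placing an operator in a block, as an additive map. -/
def liftHom {n m ι : Type*} [Fintype m] (V : ι → Matrix n m ℂ) (i : ι) :
    Matrix m m ℂ →+ Matrix n n ℂ where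
  toFun τ := V i * τ * (V i)ᴴ
  map_zero' := by simp
  map_add' ρ σ := by simp [Matrix.mul_add, Matrix.add_mul]

variable (e : OrthonormalBasis C ℂ (EuclideanSpace ℂ C))

/-- The measurement acts on one tensor factor only: a block of `a ⊗ b` is `a` times a block of `b`,
and lifting attaches `|e i⟩⟨e i|` to the second factor. -/
theorem isBlockCone_coneA : IsBlockCone (isoCol (A × B) e) (coneA A B C) (sepCone A B) where
  big := isPosCone_sepCone.comap_submatrixHom _
  small := isPosCone_sepCone
  lift_mem τ hτ i := by
    refine sepCone_induction (coneA A B C) (liftHom (isoCol (A × B) e) i)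
      (fun a b ha hb => ?_) hτ
    change (isoCol (A × B) e i * (a ⊗ₖ b) * (isoCol (A × B) e i)ᴴ).submatrix
      (equivA A B C) (equivA A B C) ∈ sepCone A (C × B)
    rw [isoCol_mul_mul]
    convert kronecker_mem_sepCone ha ((posSemidef_ketbra (e i)).kronecker hb) using 1
    ext z z'
    simp only [submatrix_apply, kroneckerMap_apply, equivA, Equiv.coe_fn_mk]
    ring
  block_mem σ hσ i := by
    have h := sepCone_induction (sepCone A B)
      ((blockHom (isoCol (A × B) e) i).comp (submatrixHom (equivA A B C).symm))
      (fun a b ha hb => ?_) hσ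
    · exact h
    change block (isoCol (A × B) e) ((a ⊗ₖ b).submatrix (equivA A B C).symm
      (equivA A B C).symm) i ∈ sepCone A B
    -- `b` acts on `C × B`, whereas `isoCol` expects the measured system last.
    have hb' : (block (isoCol B e) (b.submatrix (Equiv.prodComm B C) (Equiv.prodComm B C))
        i).PosSemidef := posSemidef_block ((posSemidef_submatrix_equiv _).2 hb) i
    convert kronecker_mem_sepCone ha hb' using 1
    ext z z'
    simp only [block_isoCol_apply, submatrix_apply, kroneckerMap_apply, equivA,
      Equiv.coe_fn_symm_mk, Equiv.prodComm_apply, Prod.swap_prod_mk, Finset.mul_sum]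
    refine Finset.sum_congr rfl fun c' _ => Finset.sum_congr rfl fun c _ => ?_
    ring

theorem isBlockCone_coneB : IsBlockCone (isoCol (A × B) e) (coneB A B C) (sepCone A B) where
  big := isPosCone_sepCone.comap_submatrixHom _
  small := isPosCone_sepCone
  lift_mem τ hτ i := by
    refine sepCone_induction (coneB A B C) (liftHom (isoCol (A × B) e) i)
      (fun a b ha hb => ?_) hτ
    change (isoCol (A × B) e i * (a ⊗ₖ b) * (isoCol (A × B) e i)ᴴ).submatrix
      (equivB A B C) (equivB A B C) ∈ sepCone (A × C) B
    rw [isoCol_mul_mul]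
    convert kronecker_mem_sepCone (ha.kronecker (posSemidef_ketbra (e i))) hb using 1
    ext z z'
    simp only [submatrix_apply, kroneckerMap_apply, equivB, Equiv.coe_fn_mk]
    ring
  block_mem σ hσ i := by
    have h := sepCone_induction (sepCone A B)
      ((blockHom (isoCol (A × B) e) i).comp (submatrixHom (equivB A B C).symm))
      (fun a b ha hb => ?_) hσ
    · exact h
    change block (isoCol (A × B) e) ((a ⊗ₖ b).submatrix (equivB A B C).symm
      (equivB A B C).symm) i ∈ sepCone A B
    convert kronecker_mem_sepCone (posSemidef_block (V := isoCol A e) ha i) hb using 1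
    ext z z'
    simp only [block_isoCol_apply, submatrix_apply, kroneckerMap_apply, equivB,
      Equiv.coe_fn_symm_mk, Finset.sum_mul]
    refine Finset.sum_congr rfl fun c' _ => Finset.sum_congr rfl fun c _ => ?_
    ring

theorem exists_ree_condState {ρ : Matrix ((A × B) × C) ((A × B) × C) ℂ} (hρ : IsState ρ) (i : C) :
    ∃ x : ℝ, 0 ≤ x ∧ coneEntropy (sepCone A B) (condState e ρ i) = x := by
  have : Nonempty (A × B) := (nonempty_of_isState hρ).map Prod.fst
  refine isPosCone_sepCone.exists_coneEntropy_eq (posSemidef_condState e hρ.1 i) ?_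
  by_cases h : prob e ρ i = 0
  · exact Or.inl (condState_eq_zero e h)
  · exact Or.inr (trace_condState e hρ.1 h)

theorem coe_sum_ereal {ι : Type*} (s : Finset ι) (f : ι → ℝ) :
    ((∑ i ∈ s, f i : ℝ) : EReal) = ∑ i ∈ s, (f i : EReal) :=
  map_sum (⟨⟨Real.toEReal, EReal.coe_zero⟩, EReal.coe_add⟩ : ℝ →+ EReal) f s

theorem avgRee_eq {ρ : Matrix ((A × B) × C) ((A × B) × C) ℂ} {x : C → ℝ}
    (hx : ∀ i, coneEntropy (sepCone A B) (condState e ρ i) = x i) :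
    avgRee e ρ = ((∑ i, prob e ρ i * x i : ℝ) : EReal) := by
  rw [coe_sum_ereal, avgRee]
  exact Finset.sum_congr rfl fun i _ => by rw [ree_eq_coneEntropy, hx, EReal.coe_mul]

theorem avgRee_le_coneEntropy {K : AddSubmonoid (Matrix ((A × B) × C) ((A × B) × C) ℂ)}
    (hK : IsBlockCone (isoCol (A × B) e) K (sepCone A B))
    {ρ : Matrix ((A × B) × C) ((A × B) × C) ℂ} (hρ : IsState ρ) :
    avgRee e ρ ≤ coneEntropy K ρ := by
  choose x _ hx using exists_ree_condState e hρ
  rw [avgRee_eq e hx]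
  exact le_coneEntropy fun σ hσ hσ1 hk => hK.sum_le_qd (isBlockFamily_isoCol e) hρ.1 hρ.2
    (prob_nonneg e hρ.1) (posSemidef_condState e hρ.1) (fun i => trace_condState e hρ.1)
    (smul_condState e hρ.1) hx hσ hσ1 hk

theorem coneEntropy_le_add_avgRee {K : AddSubmonoid (Matrix ((A × B) × C) ((A × B) × C) ℂ)}
    (hK : IsBlockCone (isoCol (A × B) e) K (sepCone A B))
    {ρ : Matrix ((A × B) × C) ((A × B) × C) ℂ} (hρ : IsState ρ) :
    coneEntropy K ρ ≤ ((qd ρ (measured e ρ) / Real.log 2 : ℝ) : EReal) + avgRee e ρ := by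
  choose x _ hx using exists_ree_condState e hρ
  rw [avgRee_eq e hx, ← EReal.coe_add]
  refine EReal.le_of_forall_lt_iff_le.1 fun z hz => ?_
  rw [EReal.coe_lt_coe_iff] at hz
  obtain ⟨σ, hσ, hσ1, hk, hle⟩ := hK.exists_qd_le (isBlockFamily_isoCol e) hρ.1
    (prob_nonneg e hρ.1) (sum_prob e hρ.2) (posSemidef_condState e hρ.1)
    (smul_condState e hρ.1) hx (sub_pos.2 hz)
  refine (coneEntropy_le hσ hσ1 hk).trans (EReal.coe_le_coe_iff.2 ?_)
  rw [← measured_eq] at hle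
  linarith

theorem prob_measured (ρ : Matrix ((A × B) × C) ((A × B) × C) ℂ) :
    prob e (measured e ρ) = prob e ρ := by
  funext i
  rw [prob_eq, prob_eq, block_measured]

theorem avgRee_measured (ρ : Matrix ((A × B) × C) ((A × B) × C) ℂ) :
    avgRee e (measured e ρ) = avgRee e ρ := by
  simp only [avgRee, condState_eq, prob_measured, block_measured]

theorem measured_measured (ρ : Matrix ((A × B) × C) ((A × B) × C) ℂ) :
    measured e (measured e ρ) = measured e ρ := by
  rw [measured_eq e (measured e ρ), block_measured, ← measured_eq]

/-- Both bounds are applied to `Π(ρ)`, which the measurement fixes and which has the same outcomes;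
the entropy term of the upper bound becomes zero. -/
theorem avgRee_eq_coneEntropy_measured
    {K : AddSubmonoid (Matrix ((A × B) × C) ((A × B) × C) ℂ)}
    (hK : IsBlockCone (isoCol (A × B) e) K (sepCone A B))
    {ρ : Matrix ((A × B) × C) ((A × B) × C) ℂ} (hρ : IsState ρ) :
    avgRee e ρ = coneEntropy K (measured e ρ) := by
  rw [← avgRee_measured]
  refine le_antisymm (avgRee_le_coneEntropy e hK (isState_measured e hρ)) ?_
  have := coneEntropy_le_add_avgRee e hK (isState_measured e hρ)
  rwa [measured_measured, qd_self, zero_div, EReal.coe_zero, zero_add] at this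

theorem reeA_le_discord_add_avgRee {ρ : Matrix ((A × B) × C) ((A × B) × C) ℂ} (hρ : IsState ρ)
    (he : IsOptimal e ρ) : reeA ρ ≤ discord ρ + avgRee e ρ := by
  rw [reeA_eq, discord_eq hρ he, ← qd_measured e hρ.1]
  exact coneEntropy_le_add_avgRee e (isBlockCone_coneA e) hρ

end Cuts

/-! ### Existence of an optimal measurement -/

section Existence

variable {n : Type*} [Fintype n] [DecidableEq n]

theorem HasDiag.trace_eq {A U : Matrix n n ℂ} {d : n → ℝ} (h : HasDiag A U d) :
    A.trace.re = ∑ a, d a := by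
  rw [h.eq, trace_mul_comm, ← Matrix.mul_assoc, h.left, Matrix.one_mul, trace_diagonal,
    Complex.re_sum]
  simp

theorem IsState.exists_hasDiag {ρ : Matrix n n ℂ} (hρ : IsState ρ) :
    ∃ U r, HasDiag ρ U r ∧ ∀ a, r a ∈ Set.Icc (0 : ℝ) 1 := by
  obtain ⟨U, r, hU, hr⟩ := exists_hasDiag_of_posSemidef hρ.1
  have h₁ : ∑ a, r a = 1 := by
    rw [← hU.trace_eq, hρ.2, Complex.one_re]
  exact ⟨U, r, hU, fun a => ⟨hr a, h₁ ▸ Finset.single_le_sum (fun b _ => hr b)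
    (Finset.mem_univ a)⟩⟩

/-- Eigenvalues of states lie in `[0, 1]`, where polynomials approximate `x log x` uniformly; the
trace is thus a uniform limit of continuous functions. -/
theorem continuousOn_entropy : ContinuousOn entropy {ρ : Matrix n n ℂ | IsState ρ} := by
  have key : ContinuousOn (fun ρ : Matrix n n ℂ => (ρ * cfc Real.log ρ).trace.re)
      {ρ | IsState ρ} := by
    refine continuousOn_of_uniform_approx_of_continuousOn fun u hu => ?_
    obtain ⟨ε, hε, hεu⟩ := Metric.mem_uniformity_dist.1 hu
    have hδ : 0 < ε / (Fintype.card n + 1) := by positivity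
    obtain ⟨q, hq⟩ := exists_polynomial_near_of_continuousOn 0 1
      (fun x => x * Real.log x) Real.continuous_mul_log.continuousOn _ hδ
    refine ⟨fun ρ => (aeval ρ q).trace.re, ?_, fun ρ hρ => hεu ?_⟩
    · exact (Complex.continuous_re.comp (q.continuous_aeval.matrix_trace)).continuousOn
    · obtain ⟨U, r, hU, hr⟩ := hρ.exists_hasDiag
      have h₁ := (hU.mul (hU.cfc Real.log)).trace_eq
      have h₂ := (hU.cfc q.eval).trace_eq
      rw [cfc_eq_aeval hU.isHermitian fun _ _ => rfl] at h₂
      dsimp only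
      rw [h₁, h₂, Real.dist_eq, ← Finset.sum_sub_distrib]
      refine (Finset.abs_sum_le_sum_abs _ _).trans_lt ?_
      have h₃ : ∀ a ∈ Finset.univ, |r a * Real.log (r a) - q.eval (r a)| ≤
          ε / (Fintype.card n + 1) := fun a _ => by
        rw [abs_sub_comm]
        exact (hq _ (hr a)).le
      refine (Finset.sum_le_card_nsmul _ _ _ h₃).trans_lt ?_
      rw [nsmul_eq_mul, Finset.card_univ, ← mul_div_assoc, div_lt_iff₀ (by positivity)]
      nlinarith
  exact (key.div_const _).neg

variable {X Y : Type*} [Fintype X] [Fintype Y] [DecidableEq X] [DecidableEq Y]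

theorem exists_orthonormalBasis_coe_eq {v : Y → EuclideanSpace ℂ Y} (hv : Orthonormal ℂ v) :
    ∃ e : OrthonormalBasis Y ℂ (EuclideanSpace ℂ Y), ⇑e = v :=
  ⟨OrthonormalBasis.mk hv
    (hv.linearIndependent.span_eq_top_of_card_eq_finrank' (by simp)).ge,
    OrthonormalBasis.coe_mk _ _⟩

theorem isCompact_orthonormal :
    IsCompact {v : Y → EuclideanSpace ℂ Y | Orthonormal ℂ v} := by
  refine Metric.isCompact_of_isClosed_isBounded ?_ ?_
  · simp only [orthonormal_iff_ite, Set.ofPred_forall]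
    refine isClosed_iInter fun i => isClosed_iInter fun j => isClosed_eq ?_ continuous_const
    exact (continuous_apply i).inner (continuous_apply j)
  · refine (Metric.isBounded_closedBall (x := 0) (r := 1)).subset fun v hv => ?_
    rw [mem_closedBall_zero_iff, pi_norm_le_iff_of_nonneg zero_le_one]
    exact fun i => (hv.1 i).le

theorem exists_isOptimal {ρ : Matrix (X × Y) (X × Y) ℂ} (hρ : IsState ρ) :
    ∃ e : OrthonormalBasis Y ℂ (EuclideanSpace ℂ Y), IsOptimal e ρ := by
  -- The measurement map is extended to arbitrary tuples of vectors, where its continuity is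
  -- evident.
  set M : (Y → EuclideanSpace ℂ Y) → Matrix (X × Y) (X × Y) ℂ := fun v =>
    ∑ i, ((1 : Matrix X X ℂ) ⊗ₖ ketbra (v i)) * ρ * ((1 : Matrix X X ℂ) ⊗ₖ ketbra (v i)) with hM
  have hcont : Continuous M := by
    refine continuous_finsetSum _ fun i _ => ?_
    have h : Continuous fun v : Y → EuclideanSpace ℂ Y =>
        (1 : Matrix X X ℂ) ⊗ₖ ketbra (v i) := by
      refine continuous_matrix fun z z' => ?_
      simp only [kroneckerMap_apply, ketbra, vecMulVec_apply]
      fun_prop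
    exact (h.matrix_mul continuous_const).matrix_mul h
  have hmaps : Set.MapsTo M {v | Orthonormal ℂ v} {ρ | IsState ρ} := by
    intro v hv
    obtain ⟨e, rfl⟩ := exists_orthonormalBasis_coe_eq hv
    exact isState_measured e hρ
  obtain ⟨v, hv, hmin⟩ := isCompact_orthonormal.exists_isMinOn
    ⟨_, (EuclideanSpace.basisFun Y ℂ).orthonormal⟩
    (continuousOn_entropy.comp hcont.continuousOn hmaps)
  obtain ⟨e, rfl⟩ := exists_orthonormalBasis_coe_eq hv
  refine ⟨e, fun f => sub_le_sub_right ?_ _⟩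
  exact isMinOn_iff.1 hmin f f.orthonormal

end Existence

/-! ### Relative entropy of a pure state -/

section PureStates

variable {n : Type*} [Fintype n] [DecidableEq n]

theorem cfc_log_of_mul_self {P : Matrix n n ℂ} (hP : P.IsHermitian) (h : P * P = P) :
    cfc Real.log P = 0 := by
  rw [cfc_eq_aeval hP (p := 0), map_zero]
  intro s hs
  rw [eval_zero]
  rcases (IsIdempotentElem.spectrum_subset ℝ h) hs with h | h
  · rw [h, Real.log_zero]
  · rw [Set.mem_singleton_iff.1 h, Real.log_one]

theorem qd_of_mul_self {P σ : Matrix n n ℂ} (hP : P.IsHermitian) (h : P * P = P) :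
    qd P σ = -(P * cfc Real.log σ).trace.re := by
  rw [qd, cfc_log_of_mul_self hP h]
  simp

/-- A pure state overlapping at most `1/2` with `σ` is at relative entropy at least one bit. -/
theorem log_two_le_qd {P σ : Matrix n n ℂ} (hP : IsState P) (h : P * P = P)
    (hσ : σ.PosSemidef) (hk : KerLE σ P) (hle : (P * σ).trace.re ≤ 1 / 2) :
    Real.log 2 ≤ qd P σ := by
  obtain ⟨U, r, hU, hr⟩ := exists_hasDiag_of_posSemidef hP.1
  obtain ⟨W, s, hW, hs⟩ := exists_hasDiag_of_posSemidef hσ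
  -- This is the tangent of the logarithm at `1/2`, `log s ≤ 2 s - 1 - log 2`, summed with the
  -- overlap weights.
  have h₁ : (P * cfc Real.log σ).trace.re ≤
      2 * (P * σ).trace.re - (1 + Real.log 2) * P.trace.re := by
    rw [hU.trace_mul (hW.cfc Real.log), hU.trace_mul hW, hU.trace_left hW]
    simp only [Finset.mul_sum, ← Finset.sum_sub_distrib]
    refine Finset.sum_le_sum fun a _ => Finset.sum_le_sum fun b _ => ?_
    rcases eq_or_lt_of_le (hs b) with hb | hb
    · have := hU.mul_eq_zero_of_kerLE hW hk a b hb.symm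
      refine le_of_eq ?_
      linear_combination (Real.log (s b) - 2 * s b + 1 + Real.log 2) * this
    · have h₂ := Real.log_le_sub_one_of_pos (mul_pos two_pos hb)
      rw [Real.log_mul two_ne_zero hb.ne'] at h₂
      have h₃ := mul_nonneg (overlap_nonneg W U b a) (hr a)
      nlinarith
  rw [hP.2, Complex.one_re] at h₁
  rw [qd_of_mul_self hP.1.isHermitian h]
  linarith

/-- From `P σ = c P` follows `P q(σ) = q(c) P` for every polynomial `q`, in particular for one
interpolating the logarithm. -/
theorem qd_of_mul_eq_smul {P σ : Matrix n n ℂ} (hP : IsState P) (h : P * P = P)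
    (hσ : σ.IsHermitian) {c : ℝ} (hc : P * σ = (c : ℂ) • P) : qd P σ = -Real.log c := by
  obtain ⟨q, hq⟩ := exists_polynomial_eval_eq
    ((finite_real_spectrum (A := σ)).toFinset ∪ {c}) Real.log
  have key (q : ℝ[X]) : P * aeval σ q = ((q.eval c : ℝ) : ℂ) • P := by
    induction q using Polynomial.induction_on' with
    | add q q' h h' => rw [map_add, Matrix.mul_add, h, h', eval_add, Complex.ofReal_add, add_smul]
    | monomial k x =>
      have hk : P * σ ^ k = ((c ^ k : ℝ) : ℂ) • P := by
        induction k with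
        | zero => simp
        | succ k ih =>
          rw [pow_succ, ← Matrix.mul_assoc, ih, smul_mul_assoc, hc, smul_smul, pow_succ,
            Complex.ofReal_mul]
      rw [aeval_monomial, eval_monomial, ← Algebra.smul_def, mul_smul_comm, hk,
        Complex.ofReal_mul, mul_smul]
      rfl
  rw [qd_of_mul_self hP.1.isHermitian h,
    cfc_eq_aeval hσ (p := q) fun s hs => hq s (by simp [hs]), key, trace_smul, hP.2,
    hq c (by simp)]
  simp

end PureStates

/-! ### Overlap of separable operators with maximally entangled vectors -/

section MaximallyEntangled

variable {X Y : Type*} [Fintype X] [Fintype Y] [DecidableEq X] [DecidableEq Y]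

theorem re_sub_sub_add_nonneg {A : Matrix X X ℂ} (hA : A.PosSemidef) (i j : X) :
    0 ≤ (A i i - A i j - A j i + A j j).re := by
  have h := hA.dotProduct_mulVec_nonneg (Pi.single i 1 - Pi.single j 1)
  have e : star (Pi.single i 1 - Pi.single j 1 : X → ℂ) ⬝ᵥ
      (A *ᵥ (Pi.single i 1 - Pi.single j 1)) = A i i - A i j - A j i + A j j := by
    rw [mulVec_sub, mulVec_single_one, mulVec_single_one, star_sub, ← Pi.single_star,
      ← Pi.single_star, star_one, sub_dotProduct, single_one_dotProduct, single_one_dotProduct]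
    simp only [Pi.sub_apply, col_apply]
    ring
  rw [e] at h
  exact (Complex.le_def.1 h).1

theorem re_add_re_le_trace {A : Matrix X X ℂ} (hA : A.PosSemidef) {i j : X} (hij : i ≠ j) :
    (A i i).re + (A j j).re ≤ A.trace.re := by
  rw [trace, Complex.re_sum, ← Finset.sum_pair (f := fun k => (A k k).re) hij]
  exact Finset.sum_le_sum_of_subset_of_nonneg (Finset.subset_univ _)
    fun k _ _ => (Complex.le_def.1 hA.diag_nonneg).1

/-- The overlap of a separable operator with a two-level maximally entangled vector. -/
theorem re_add_le_trace_of_mem_sepCone {σ : Matrix (X × Y) (X × Y) ℂ} (hσ : σ ∈ sepCone X Y)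
    {p q : X × Y} (h₁ : p.1 ≠ q.1) (h₂ : p.2 ≠ q.2) :
    (σ p p + σ p q + σ q p + σ q q).re ≤ σ.trace.re := by
  have h := sepCone_induction (AddSubmonoid.nonneg ℝ)
    (⟨⟨fun σ : Matrix (X × Y) (X × Y) ℂ =>
      σ.trace.re - (σ p p + σ p q + σ q p + σ q q).re, by simp⟩, fun σ τ => by
        simp only [trace_add, Matrix.add_apply, Complex.add_re]; ring⟩ :
      Matrix (X × Y) (X × Y) ℂ →+ ℝ) (fun a b ha hb => ?_) hσ
  · exact sub_nonneg.1 (AddSubmonoid.mem_nonneg.1 h)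
  refine AddSubmonoid.mem_nonneg.2 (sub_nonneg.2 ?_)
  -- Partial transposition keeps products positive and moves the coherences between `p` and `q` to
  -- the entries between `(p.1, q.2)` and `(q.1, p.2)`. They are thus bounded by the two mixed
  -- diagonal terms, which complete the product of sums in `e₅`.
  have e₁ := re_sub_sub_add_nonneg (ha.kronecker hb.transpose) (p.1, q.2) (q.1, p.2)
  have e₂ := re_add_re_le_trace ha h₁
  have e₃ := re_add_re_le_trace hb h₂
  have ra (x : X) := (Complex.le_def.1 (ha.diag_nonneg (i := x)))
  have rb (y : Y) := (Complex.le_def.1 (hb.diag_nonneg (i := y)))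
  have ia (x : X) : (a x x).im = 0 := (ra x).2.symm
  have ib (y : Y) : (b y y).im = 0 := (rb y).2.symm
  have e₄ : (a ⊗ₖ b).trace.re = a.trace.re * b.trace.re := by
    rw [trace_kronecker, trace_eq_re ha, trace_eq_re hb, ← Complex.ofReal_mul, Complex.ofReal_re,
      Complex.ofReal_re, Complex.ofReal_re]
  have e₅ := mul_le_mul e₂ e₃ (add_nonneg (rb p.2).1 (rb q.2).1) (trace_re_nonneg ha)
  rw [e₄]
  refine le_trans ?_ e₅
  simp only [kroneckerMap_apply, transpose_apply, Complex.add_re, Complex.sub_re, Complex.mul_re,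
    ia, ib] at e₁ ⊢
  linarith

end MaximallyEntangled

/-! ### The GHZ state -/

section GHZ

theorem ghzVec_mul_self_sum (c : Fin 2) :
    ∑ k : (Fin 2 × Fin 2) × Fin 2, (if k.2 = c then ghzVec k * ghzVec k else 0) = 1 / 2 := by
  have h : ((Real.sqrt 2 : ℝ) : ℂ)⁻¹ * ((Real.sqrt 2 : ℝ) : ℂ)⁻¹ = 1 / 2 := by
    rw [← mul_inv, ← Complex.ofReal_mul, Real.mul_self_sqrt (by norm_num)]
    norm_num
  fin_cases c <;> simp [Fintype.sum_prod_type, ghzVec, h]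

theorem star_ghzVec (z : (Fin 2 × Fin 2) × Fin 2) : star (ghzVec z) = ghzVec z := by
  simp only [ghzVec, apply_ite star, star_zero, star_inv₀, Complex.star_def, Complex.conj_ofReal]

theorem ghz_apply (z z' : (Fin 2 × Fin 2) × Fin 2) : ghz z z' = ghzVec z * ghzVec z' := by
  rw [ghz, ketbra, vecMulVec_apply, star_ghzVec]

theorem sum_ghzVec_mul_self : ∑ k, ghzVec k * ghzVec k = 1 := by
  have h : ∑ c : Fin 2, ∑ k : (Fin 2 × Fin 2) × Fin 2,
      (if k.2 = c then ghzVec k * ghzVec k else 0) = 1 := by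
    simp only [ghzVec_mul_self_sum]
    norm_num
  rw [Finset.sum_comm] at h
  simpa using h

theorem isState_ghz : IsState ghz := by
  refine ⟨posSemidef_ketbra _, ?_⟩
  simp only [trace, diag_apply, ghz_apply]
  exact sum_ghzVec_mul_self

theorem ghz_mul_self : ghz * ghz = ghz := by
  ext z z'
  simp only [mul_apply, ghz_apply]
  calc _ = ghzVec z * (∑ k, ghzVec k * ghzVec k) * ghzVec z' := by
        rw [Finset.mul_sum, Finset.sum_mul]
        exact Finset.sum_congr rfl fun k _ => by ring
    _ = _ := by rw [sum_ghzVec_mul_self, mul_one]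

theorem trace_ghz_mul (σ : Matrix ((Fin 2 × Fin 2) × Fin 2) ((Fin 2 × Fin 2) × Fin 2) ℂ) :
    (ghz * σ).trace = 1 / 2 * (σ ((0, 0), 0) ((0, 0), 0) + σ ((0, 0), 0) ((1, 1), 1) +
      σ ((1, 1), 1) ((0, 0), 0) + σ ((1, 1), 1) ((1, 1), 1)) := by
  have h : ((Real.sqrt 2 : ℝ) : ℂ)⁻¹ * ((Real.sqrt 2 : ℝ) : ℂ)⁻¹ = 1 / 2 := by
    rw [← mul_inv, ← Complex.ofReal_mul, Real.mul_self_sqrt (by norm_num)]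
    norm_num
  simp only [trace, diag_apply, mul_apply, ghz_apply]
  simp [Fintype.sum_prod_type, ghzVec, h]
  ring

/-- The GHZ overlap is half the sum of the four entries, hence at most `1/2`. The hypothesis holds
in every cut, since `000` and `111` differ on both sides of it. -/
theorem one_le_coneEntropy_ghz {K : AddSubmonoid (Matrix ((Fin 2 × Fin 2) × Fin 2) _ ℂ)}
    (hK : ∀ σ ∈ K, σ.PosSemidef)
    (h : ∀ σ ∈ K, (σ ((0, 0), 0) ((0, 0), 0) + σ ((0, 0), 0) ((1, 1), 1) +
      σ ((1, 1), 1) ((0, 0), 0) + σ ((1, 1), 1) ((1, 1), 1)).re ≤ σ.trace.re) :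
    1 ≤ coneEntropy K ghz := by
  rw [← EReal.coe_one]
  refine le_coneEntropy fun σ hσ htr hk => ?_
  rw [one_le_div log_two_pos]
  refine log_two_le_qd isState_ghz ghz_mul_self (hK σ hσ) hk ?_
  have := h σ hσ
  rw [htr, Complex.one_re] at this
  rw [trace_ghz_mul, one_div, ← Complex.ofReal_ofNat, ← Complex.ofReal_inv, Complex.re_ofReal_mul]
  linarith

theorem one_le_reeA_ghz : 1 ≤ reeA ghz := by
  rw [reeA_eq]
  refine one_le_coneEntropy_ghz (isPosCone_sepCone.comap_submatrixHom _).psd fun σ hσ => ?_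
  have := re_add_le_trace_of_mem_sepCone (σ := σ.submatrix (equivA _ _ _) (equivA _ _ _)) hσ
    (p := (0, 0, 0)) (q := (1, 1, 1)) (by simp) (by simp)
  rwa [trace_submatrix_equiv] at this

theorem one_le_reeB_ghz : 1 ≤ reeB ghz := by
  rw [reeB_eq]
  refine one_le_coneEntropy_ghz (isPosCone_sepCone.comap_submatrixHom _).psd fun σ hσ => ?_
  have := re_add_le_trace_of_mem_sepCone (σ := σ.submatrix (equivB _ _ _) (equivB _ _ _)) hσ
    (p := ((0, 0), 0)) (q := ((1, 1), 1)) (by simp) (by simp)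
  rwa [trace_submatrix_equiv] at this

theorem one_le_coneEntropy_sepCone_ghz : 1 ≤ coneEntropy (sepCone (Fin 2 × Fin 2) (Fin 2)) ghz :=
  one_le_coneEntropy_ghz isPosCone_sepCone.psd fun _ hσ =>
    re_add_le_trace_of_mem_sepCone hσ (by simp) (by simp)

theorem measured_mem_sepCone {X Y : Type*} [Fintype X] [Fintype Y] [DecidableEq X] [DecidableEq Y]
    (e : OrthonormalBasis Y ℂ (EuclideanSpace ℂ Y)) {ρ : Matrix (X × Y) (X × Y) ℂ}
    (hρ : ρ.PosSemidef) : measured e ρ ∈ sepCone X Y := by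
  rw [measured_eq, blockSum_isoCol]
  exact sum_mem fun i _ => kronecker_mem_sepCone (posSemidef_block hρ i) (posSemidef_ketbra _)

/-- Every measured state is separable in the cut `AB : C`, so the one-bit bound for that cut
applies. -/
theorem one_le_entropy_measured_ghz (f : OrthonormalBasis (Fin 2) ℂ (EuclideanSpace ℂ (Fin 2))) :
    1 ≤ entropy (measured f ghz) - entropy ghz := by
  have h := one_le_coneEntropy_sepCone_ghz.trans
    (coneEntropy_le (measured_mem_sepCone f isState_ghz.1) (isState_measured f isState_ghz).2
      (kerLE_measured f isState_ghz.1))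
  rw [qd_measured f isState_ghz.1] at h
  exact_mod_cast h

/-- The computational basis. -/
abbrev stdBasis : OrthonormalBasis (Fin 2) ℂ (EuclideanSpace ℂ (Fin 2)) :=
  EuclideanSpace.basisFun (Fin 2) ℂ

theorem block_stdBasis_ghz (i : Fin 2) (x x' : Fin 2 × Fin 2) :
    block (isoCol (Fin 2 × Fin 2) stdBasis) ghz i x x' = ghzVec (x, i) * ghzVec (x', i) := by
  simp [block_isoCol_apply, ghz_apply, PiLp.single_apply]

/-- GHZ is an eigenvector of its dephased state with eigenvalue `1/2`, so the entropy increase is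
exactly one bit. -/
theorem ghz_mul_measured : ghz * measured stdBasis ghz = ((1 / 2 : ℝ) : ℂ) • ghz := by
  have hm (k z : (Fin 2 × Fin 2) × Fin 2) : measured stdBasis ghz k z =
      if k.2 = z.2 then ghzVec k * ghzVec z else 0 := by
    obtain ⟨k, c⟩ := k
    obtain ⟨z, c'⟩ := z
    simp only [measured_eq, blockSum_isoCol, Matrix.sum_apply, kroneckerMap_apply,
      block_stdBasis_ghz, ketbra, vecMulVec_apply]
    fin_cases c <;> fin_cases c' <;> simp
  ext z z'
  simp only [mul_apply, hm, ghz_apply, Matrix.smul_apply, smul_eq_mul]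
  calc _ = ghzVec z * (∑ k : (Fin 2 × Fin 2) × Fin 2,
        if k.2 = z'.2 then ghzVec k * ghzVec k else 0) * ghzVec z' := by
        rw [Finset.mul_sum, Finset.sum_mul]
        refine Finset.sum_congr rfl fun k _ => ?_
        split_ifs <;> ring
    _ = _ := by
        rw [ghzVec_mul_self_sum]
        push_cast
        ring

theorem entropy_measured_stdBasis_ghz : entropy (measured stdBasis ghz) - entropy ghz = 1 := by
  rw [← qd_measured _ isState_ghz.1, qd_of_mul_eq_smul isState_ghz ghz_mul_self
    (isState_measured _ isState_ghz).1.isHermitian ghz_mul_measured, one_div, Real.log_inv,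
    neg_neg, div_self log_two_pos.ne']

theorem isOptimal_stdBasis_ghz : IsOptimal stdBasis ghz := fun f => by
  rw [entropy_measured_stdBasis_ghz]
  exact one_le_entropy_measured_ghz f

theorem measured_stdBasis_ghz_mem : measured stdBasis ghz ∈ coneA (Fin 2) (Fin 2) (Fin 2) := by
  rw [measured_eq]
  refine sum_mem fun i _ => (isBlockCone_coneA stdBasis).lift_mem _ ?_ i
  have h : ((Real.sqrt 2 : ℝ) : ℂ)⁻¹ * ((Real.sqrt 2 : ℝ) : ℂ)⁻¹ = ((1 / 2 : ℝ) : ℂ) := by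
    rw [← mul_inv, ← Complex.ofReal_mul, Real.mul_self_sqrt (by norm_num)]
    norm_num
  have e : block (isoCol (Fin 2 × Fin 2) stdBasis) ghz i =
      ((1 / 2 : ℝ) : ℂ) • (ketbra (stdBasis i) ⊗ₖ ketbra (stdBasis i)) := by
    ext ⟨x, y⟩ ⟨x', y'⟩
    rw [block_stdBasis_ghz, ← h, Matrix.smul_apply, kroneckerMap_apply]
    simp only [ketbra, vecMulVec_apply, ghzVec]
    fin_cases i <;> fin_cases x <;> fin_cases y <;> fin_cases x' <;> fin_cases y' <;> simp
  rw [e]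
  exact smul_mem_sepCone (by norm_num)
    (kronecker_mem_sepCone (posSemidef_ketbra _) (posSemidef_ketbra _))

theorem avgRee_stdBasis_ghz : avgRee stdBasis ghz = 0 := by
  refine le_antisymm ?_ ?_
  · rw [avgRee_eq_coneEntropy_measured stdBasis (isBlockCone_coneA stdBasis) isState_ghz]
    have := coneEntropy_le measured_stdBasis_ghz_mem (isState_measured _ isState_ghz).2
      (kerLE_refl _)
    rwa [qd_self, zero_div, EReal.coe_zero] at this
  · choose x hx0 hx using exists_ree_condState stdBasis isState_ghz
    rw [avgRee_eq _ hx, ← EReal.coe_zero, EReal.coe_le_coe_iff]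
    exact Finset.sum_nonneg fun i _ => mul_nonneg (prob_nonneg _ isState_ghz.1 i) (hx0 i)

theorem discord_ghz : discord ghz = 1 := by
  rw [discord_eq isState_ghz isOptimal_stdBasis_ghz, entropy_measured_stdBasis_ghz, EReal.coe_one]

end GHZ

end

end QCorr

theorem mainTheorem2 :
    (∀ (A B C : Type*) [Fintype A] [Fintype B] [Fintype C]
      [DecidableEq A] [DecidableEq B] [DecidableEq C]
      (ρ : Matrix ((A × B) × C) ((A × B) × C) ℂ), IsState ρ →
        -- an optimal measurement exists
        (∃ e : OrthonormalBasis C ℂ (EuclideanSpace ℂ C), IsOptimal e ρ) ∧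
        ∀ e : OrthonormalBasis C ℂ (EuclideanSpace ℂ C), IsOptimal e ρ →
          measured e ρ = ∑ i, (prob e ρ i : ℂ) • (condState e ρ i ⊗ₖ ketbra (e i)) ∧
          reeA ρ ≤ discord ρ + avgRee e ρ ∧
          avgRee e ρ = reeA (measured e ρ) ∧
          avgRee e ρ = reeB (measured e ρ) ∧
          -- the bound is never worse than `E_{A:CB}(ρ) ≤ D_{AB|C}(ρ) + E_{AC:B}(ρ)`
          discord ρ + avgRee e ρ ≤ discord ρ + reeB ρ) ∧
    -- for the GHZ state it is tight and strictly better
    (IsState ghz ∧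
      ∃ e : OrthonormalBasis (Fin 2) ℂ (EuclideanSpace ℂ (Fin 2)), IsOptimal e ghz ∧
        reeA ghz = discord ghz + avgRee e ghz ∧
        discord ghz + avgRee e ghz < discord ghz + reeB ghz) := by
  refine ⟨fun A B C _ _ _ _ _ _ ρ hρ => ⟨exists_isOptimal hρ, fun e he =>
    ⟨measured_eq_sum e hρ.1, reeA_le_discord_add_avgRee e hρ he, ?_, ?_, ?_⟩⟩,
    isState_ghz, stdBasis, isOptimal_stdBasis_ghz, ?_, ?_⟩
  · rw [reeA_eq]
    exact avgRee_eq_coneEntropy_measured e (isBlockCone_coneA e) hρ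
  · rw [reeB_eq]
    exact avgRee_eq_coneEntropy_measured e (isBlockCone_coneB e) hρ
  · rw [reeB_eq]
    exact add_le_add_right (avgRee_le_coneEntropy e (isBlockCone_coneB e) hρ) _
  · refine le_antisymm (reeA_le_discord_add_avgRee _ isState_ghz isOptimal_stdBasis_ghz) ?_
    rw [discord_ghz, avgRee_stdBasis_ghz, add_zero]
    exact one_le_reeA_ghz
  · rw [discord_ghz, avgRee_stdBasis_ghz, add_zero]
    -- The gap is `1 < 1 + 1 ≤ 1 + E_{AC:B}`.
    refine lt_of_lt_of_le ?_ (add_le_add_right one_le_reeB_ghz 1)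
    norm_num
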